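/- **Theorem 3.** Let $n,m,N,M$ be non-negative integers and let $\Omega\subset\mathbb R^n$ be open. Write $C_0(\Omega)$ for the continuous functions with compact support in $\Omega$, $F(u)(\xi)=\int_{\mathbb R^n}e^{-2\pi i\xi\cdot x}u(x)\,dx$ for the Fourier transform, extended to a unitary operator on $L^2(\mathbb R^n)=L^2(\mathbb R^n,\mathbb C)$, and, for $\psi\in L^\infty(\mathbb R^n)$ and $\Phi\in C_0(\mathbb R^n)$, let $A_\psi,B_\Phi$ be the bounded operators on $L^2(\mathbb R^n)$ given by $F(A_\psi u)=\psi F(u)$ and $B_\Phi u=\Phi u$. Let $A\subset L^\infty(\mathbb R^n)$ be the algebra of admissible symbols, i.e. of those $\psi$ for which the commutator $[A_\psi,B_\Phi]$ is a compact operator on $L^2(\mathbb R^n)$ for every $\Phi\in C_0(\mathbb R^n)$; let $A_0\subset A$ be the ideal of the symbols with $\operatorname{ess\,lim}_{|\xi|\to\infty}\psi(\xi)=0$; let $\mathfrak S$ be the spectrum of the quotient algebra $\mathcal A=A/A_0$, i.e. the set of its nonzero multiplicative linear functionals $\mathcal A\to\mathbb C$; and let $\hat\psi(\eta)=\eta([\psi])$,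 $\eta\in\mathfrak S$, be the Gelfand transform of (the class of) $\psi\in A$. Let $p_{s\alpha k}\in A$ be symbols, let $p_{s\alpha k}(\partial/\partial x)=A_{p_{s\alpha k}}$ be the corresponding pseudo-differential operators, and let $c_{s\alpha k}\in C(\Omega)$ be complex-valued continuous functions, where $1\le s\le m$, $1\le\alpha\le N$, $1\le k\le M$. Let $u_r=(u_r^1,\dots,u_r^N)\in L^2_{loc}(\Omega,\mathbb C^N)$, $r\in\mathbb N$, converge weakly in $L^2_{loc}(\Omega,\mathbb C^N)$ to $u\in L^2_{loc}(\Omega,\mathbb C^N)$, and suppose that for every $\Phi\in C_0^\infty(\Omega)$ and every $s=1,\dots,m$ the sequence (in $r$) $$\sum_{\alpha=1}^N\sum_{k=1}^M c_{s\alpha k}(x)\,p_{s\alpha k}(\partial/\partial x)\bigl(\Phi(x)u_r^\alpha(x)\bigr)\quad\text{is precompact in }L^2_{loc}(\Omega),$$ where $\Phi u_r^\alpha$ is extended by zero outside $\Omega$. For $x\in\Omega$ put $$\Lambda(x)=\Bigl\{\lambda\in\mathbb C^N\ \Big|\ \exists\,\eta\in\mathfrak S:\ \sum_{\alpha=1}^N\sum_{k=1}^M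 c_{s\alpha k}(x)\,\widehat{p_{s\alpha k}}(\eta)\,\lambda_\alpha=0\ \ \forall s=1,\dots,m\Bigr\}.$$ Let $q(x,\lambda)=\sum_{\alpha,\beta=1}^N q_{\alpha\beta}(x)\lambda_\alpha\overline{\lambda_\beta}$ be a Hermitian form with coefficients $q_{\alpha\beta}\in C(\Omega)$ (the matrix $(q_{\alpha\beta}(x))$ is Hermitian for each $x\in\Omega$). Let $v$ be a real locally finite (Radon) measure on $\Omega$ such that $q(x,u_r)\rightharpoonup v$ weakly in $M_{loc}(\Omega)$, i.e. $\int_\Omega\Phi(x)\,q(x,u_r(x))\,dx\to\int_\Omega\Phi\,dv$ for every $\Phi\in C_0(\Omega)$. If $q(x,\lambda)\ge0$ for all $x\in\Omega$ and all $\lambda\in\Lambda(x)$, then $q(x,u(x))\,dx\le v$ in the sense of measures on $\Omega$, i.e. $\int_B q(x,u(x))\,dx\le v(B)$ for every Borel set $B$ contained in a compact subset of $\Omega$. -/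

import Mathlib

open MeasureTheory Filter Topology TopologicalSpace
open scoped ENNReal Distributions CompactlySupported FourierTransform

noncomputable section

namespace AdmissibleSymbols

/-- The Euclidean space `ℝⁿ`. -/
abbrev Rn (n : ℕ) : Type := EuclideanSpace ℝ (Fin n)

/-- The Hilbert space `L²(ℝⁿ) = L²(ℝⁿ, ℂ)`. -/
abbrev L2 (n : ℕ) : Type := Lp ℂ 2 (volume : Measure (Rn n))

/-- Classes of measurable functions form a commutative ring under pointwise operations. -/
instance commRingAEEqFun (n : ℕ) : CommRing (Rn n →ₘ[volume] ℂ) where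
  __ := (inferInstance : AddCommGroup (Rn n →ₘ[volume] ℂ))
  __ := (inferInstance : CommMonoid (Rn n →ₘ[volume] ℂ))
  left_distrib f g h := by
    apply AEEqFun.ext
    filter_upwards [AEEqFun.coeFn_mul f (g + h), AEEqFun.coeFn_add g h,
      AEEqFun.coeFn_add (f * g) (f * h), AEEqFun.coeFn_mul f g, AEEqFun.coeFn_mul f h]
      with x h1 h2 h3 h4 h5
    rw [h1, h3]
    simp only [Pi.mul_apply, Pi.add_apply, h2, h4, h5, mul_add]
  right_distrib f g h := by
    apply AEEqFun.ext
    filter_upwards [AEEqFun.coeFn_mul (f + g) h, AEEqFun.coeFn_add f g,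
      AEEqFun.coeFn_add (f * h) (g * h), AEEqFun.coeFn_mul f h, AEEqFun.coeFn_mul g h]
      with x h1 h2 h3 h4 h5
    rw [h1, h3]
    simp only [Pi.mul_apply, Pi.add_apply, h2, h4, h5, add_mul]
  zero_mul f := by
    apply AEEqFun.ext
    filter_upwards [AEEqFun.coeFn_mul 0 f,
      AEEqFun.coeFn_zero (α := Rn n) (β := ℂ) (μ := volume)] with x h1 h2
    rw [h1]
    simp [h2]
  mul_zero f := by
    apply AEEqFun.ext
    filter_upwards [AEEqFun.coeFn_mul f 0,
      AEEqFun.coeFn_zero (α := Rn n) (β := ℂ) (μ := volume)] with x h1 h2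
    rw [h1]
    simp [h2]

/-- Classes of measurable functions form a complex algebra under pointwise operations. -/
instance algebraAEEqFun (n : ℕ) : Algebra ℂ (Rn n →ₘ[volume] ℂ) :=
  Algebra.ofModule
    (fun c f g => by
      apply AEEqFun.ext
      filter_upwards [AEEqFun.coeFn_mul (c • f) g, AEEqFun.coeFn_smul c f,
        AEEqFun.coeFn_smul c (f * g), AEEqFun.coeFn_mul f g] with x h1 h2 h3 h4
      rw [h1, h3]
      simp only [Pi.mul_apply, Pi.smul_apply, h2, h4, smul_mul_assoc])
    (fun c f g => by
      apply AEEqFun.ext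
      filter_upwards [AEEqFun.coeFn_mul f (c • g), AEEqFun.coeFn_smul c g,
        AEEqFun.coeFn_smul c (f * g), AEEqFun.coeFn_mul f g] with x h1 h2 h3 h4
      rw [h1, h3]
      simp only [Pi.mul_apply, Pi.smul_apply, h2, h4, mul_smul_comm])

lemma coeFn_algebraMap {n : ℕ} (c : ℂ) :
    (algebraMap ℂ (Rn n →ₘ[volume] ℂ) c : Rn n → ℂ) =ᵐ[volume] fun _ => c := by
  rw [Algebra.algebraMap_eq_smul_one]
  filter_upwards [AEEqFun.coeFn_smul c (1 : Rn n →ₘ[volume] ℂ),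
    AEEqFun.coeFn_one (α := Rn n) (β := ℂ) (μ := volume)] with x h1 h2
  rw [h1]
  simp [h2]

/-- The algebra `L^∞(ℝⁿ)` of (classes of) essentially bounded measurable functions. -/
def Linf (n : ℕ) : Subalgebra ℂ (Rn n →ₘ[volume] ℂ) where
  carrier := {f | f ∈ Lp ℂ ∞ (volume : Measure (Rn n))}
  mul_mem' {f g} hf hg := by
    simp only [Set.mem_ofPred_eq, Lp.mem_Lp_iff_memLp] at *
    exact (memLp_congr_ae (AEEqFun.coeFn_mul f g)).2 (MemLp.mul (r := ∞) hg hf)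
  add_mem' {f g} hf hg := by
    simp only [Set.mem_ofPred_eq] at *
    exact add_mem hf hg
  algebraMap_mem' c := by
    simp only [Set.mem_ofPred_eq, Lp.mem_Lp_iff_memLp]
    refine (memLp_congr_ae (coeFn_algebraMap c)).2 ?_
    exact memLp_top_const c

lemma mem_Linf {n : ℕ} {f : Rn n →ₘ[volume] ℂ} :
    f ∈ Linf n ↔ f ∈ Lp ℂ ∞ (volume : Measure (Rn n)) := Iff.rfl

/-- An element of `L^∞(ℝⁿ)` as an element of Mathlib's `Lp ℂ ∞`. -/
def toLinfty {n : ℕ} (ψ : Linf n) : Lp ℂ ∞ (volume : Measure (Rn n)) := ⟨ψ.1, mem_Linf.1 ψ.2⟩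

/-- The operator `u ↦ ψ u` of multiplication by `ψ ∈ L^∞(ℝⁿ)` on `L²(ℝⁿ)`. -/
def mulOp {n : ℕ} (ψ : Linf n) : L2 n →L[ℂ] L2 n :=
  (ContinuousLinearMap.mul ℂ ℂ).holderL volume ∞ 2 2 (toLinfty ψ)

/-- The operator `A_ψ` with symbol `ψ(ξ)`: `F (A_ψ u) = ψ F u`, with
`F u (ξ) = ∫ exp (-2πi ξ·x) u(x) dx` extended to a unitary operator of `L²(ℝⁿ)`. -/
def symbolOp {n : ℕ} (ψ : Linf n) : L2 n →L[ℂ] L2 n :=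
  ((Lp.fourierTransformₗᵢ (Rn n) ℂ).symm : L2 n →L[ℂ] L2 n) ∘L mulOp ψ ∘L
    (Lp.fourierTransformₗᵢ (Rn n) ℂ : L2 n →L[ℂ] L2 n)

/-- A continuous compactly supported function as an element of `L^∞(ℝⁿ)`. -/
def ofCc {n : ℕ} (Φ : C_c(Rn n, ℂ)) : Linf n :=
  ⟨((Φ.continuous.memLp_top_of_hasCompactSupport Φ.hasCompactSupport volume).toLp Φ).1,
    mem_Linf.2
      ((Φ.continuous.memLp_top_of_hasCompactSupport Φ.hasCompactSupport volume).toLp Φ).2⟩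

/-- The commutator `[A_ψ, B_Φ]`, where `B_Φ u = Φ u`. -/
def commutator {n : ℕ} (ψ : Linf n) (Φ : C_c(Rn n, ℂ)) : L2 n →L[ℂ] L2 n :=
  symbolOp ψ ∘L mulOp (ofCc Φ) - mulOp (ofCc Φ) ∘L symbolOp ψ

lemma coeFn_mulOp {n : ℕ} (ψ : Linf n) (u : L2 n) :
    mulOp ψ u =ᵐ[volume] fun x => ψ.1 x * u x :=
  ContinuousLinearMap.coeFn_holder (r := 2) (ContinuousLinearMap.mul ℂ ℂ) (toLinfty ψ) u

lemma mulOp_add {n : ℕ} (ψ φ : Linf n) : mulOp (ψ + φ) = mulOp ψ + mulOp φ := by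
  unfold mulOp
  rw [← map_add]
  rfl

lemma mulOp_mul {n : ℕ} (ψ φ : Linf n) : mulOp (ψ * φ) = mulOp ψ ∘L mulOp φ := by
  ext1 u
  apply Lp.ext
  filter_upwards [coeFn_mulOp (ψ * φ) u, coeFn_mulOp ψ (mulOp φ u), coeFn_mulOp φ u,
    AEEqFun.coeFn_mul ψ.1 φ.1] with x h1 h2 h3 h4
  have h5 : (ψ * φ).1 x = ψ.1 x * φ.1 x := h4
  rw [h1, ContinuousLinearMap.comp_apply, h2, h3, h5, mul_assoc]

lemma mulOp_algebraMap {n : ℕ} (c : ℂ) :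
    mulOp (algebraMap ℂ (Linf n) c) = c • ContinuousLinearMap.id ℂ (L2 n) := by
  ext1 u
  apply Lp.ext
  filter_upwards [coeFn_mulOp (algebraMap ℂ (Linf n) c) u, Lp.coeFn_smul c u,
    coeFn_algebraMap (n := n) c] with x h1 h2 h3
  have h4 : (algebraMap ℂ (Linf n) c).1 x = c := h3
  rw [h1, h4, smul_apply, ContinuousLinearMap.id_apply, h2]
  rfl

lemma symbolOp_add {n : ℕ} (ψ φ : Linf n) : symbolOp (ψ + φ) = symbolOp ψ + symbolOp φ := by
  ext1 u
  simp [symbolOp, mulOp_add]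

lemma symbolOp_mul {n : ℕ} (ψ φ : Linf n) : symbolOp (ψ * φ) = symbolOp ψ ∘L symbolOp φ := by
  ext1 u
  simp [symbolOp, mulOp_mul]

lemma symbolOp_algebraMap {n : ℕ} (c : ℂ) :
    symbolOp (algebraMap ℂ (Linf n) c) = c • ContinuousLinearMap.id ℂ (L2 n) := by
  ext1 u
  simp [symbolOp, mulOp_algebraMap]

/-- The algebra `A` of admissible symbols: those `ψ ∈ L^∞(ℝⁿ)` for which `[A_ψ, B_Φ]` is a
compact operator on `L²(ℝⁿ)` for every continuous compactly supported `Φ`. -/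
def symbolAlgebra (n : ℕ) : Subalgebra ℂ (Linf n) where
  carrier := {ψ | ∀ Φ : C_c(Rn n, ℂ), IsCompactOperator (commutator ψ Φ)}
  mul_mem' {ψ φ} hψ hφ Φ := by
    have h : commutator (ψ * φ) Φ
        = symbolOp ψ ∘L commutator φ Φ + commutator ψ Φ ∘L symbolOp φ := by
      ext1 u
      simp [commutator, symbolOp_mul]
    rw [h]
    exact ((hφ Φ).clm_comp (symbolOp ψ)).add ((hψ Φ).comp_clm (symbolOp φ))
  add_mem' {ψ φ} hψ hφ Φ := by
    have h : commutator (ψ + φ) Φ = commutator ψ Φ + commutator φ Φ := by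
      ext1 u
      simp [commutator, symbolOp_add]
      abel
    rw [h]
    exact (hψ Φ).add (hφ Φ)
  algebraMap_mem' c Φ := by
    have h : commutator (algebraMap ℂ (Linf n) c) Φ = 0 := by
      ext1 u
      simp [commutator, symbolOp_algebraMap]
    rw [h]
    exact isCompactOperator_zero

/-- The ideal `A₀` of the symbols vanishing at infinity, `ess lim_{|ξ| → ∞} ψ(ξ) = 0`. -/
def vanishingIdeal (n : ℕ) : Ideal (symbolAlgebra n) where
  carrier := {ψ | Tendsto (ψ.1.1 : Rn n → ℂ) (cocompact (Rn n) ⊓ ae volume) (𝓝 0)}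
  zero_mem' := by
    have h := (AEEqFun.coeFn_zero (α := Rn n) (β := ℂ) (μ := volume)).filter_mono
      (inf_le_right : cocompact (Rn n) ⊓ ae volume ≤ ae volume)
    exact Tendsto.congr' h.symm tendsto_const_nhds
  add_mem' {ψ φ} hψ hφ := by
    have h := (AEEqFun.coeFn_add ψ.1.1 φ.1.1).filter_mono
      (inf_le_right : cocompact (Rn n) ⊓ ae volume ≤ ae volume)
    refine Tendsto.congr' h.symm ?_
    have h' := Tendsto.add hψ hφ
    rw [add_zero] at h'
    exact h'
  smul_mem' ψ φ hφ := by
    have h := (AEEqFun.coeFn_mul ψ.1.1 φ.1.1).filter_mono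
      (inf_le_right : cocompact (Rn n) ⊓ ae volume ≤ ae volume)
    refine Tendsto.congr' h.symm ?_
    have hb : ∀ᵐ x ∂(volume : Measure (Rn n)),
        ‖ψ.1.1 x‖ ≤ (eLpNorm ψ.1.1 ∞ volume).toReal := by
      have hf := (Lp.mem_Lp_iff_memLp.1 (mem_Linf.1 ψ.1.2)).eLpNorm_ne_top
      rw [eLpNorm_exponent_top] at hf ⊢
      filter_upwards [ae_le_eLpNormEssSup (f := ψ.1.1) (μ := (volume : Measure (Rn n)))] with x hx
      rw [← toReal_enorm]
      exact ENNReal.toReal_mono hf hx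
    have hb' : IsBoundedUnder (· ≤ ·) (cocompact (Rn n) ⊓ ae volume)
        (norm ∘ (ψ.1.1 : Rn n → ℂ)) :=
      ⟨_, eventually_map.2 (hb.filter_mono inf_le_right)⟩
    exact isBoundedUnder_le_mul_tendsto_zero hb' hφ

/-- The quotient algebra `A / A₀`. -/
abbrev quotientAlgebra (n : ℕ) : Type := symbolAlgebra n ⧸ vanishingIdeal n

/-- The spectrum `𝔖` of `A / A₀`: the (unital) multiplicative linear functionals. -/
abbrev spectrumS (n : ℕ) : Type := quotientAlgebra n →ₐ[ℂ] ℂ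

/-- The Gelfand transform `ψ ↦ ψ̂(η)` of (the class in `A / A₀` of) `ψ ∈ A`. -/
def gelfand {n : ℕ} (ψ : symbolAlgebra n) (η : spectrumS n) : ℂ :=
  η (Ideal.Quotient.mk (vanishingIdeal n) ψ)

/-- Membership in `L²_loc(Ω)`. Values outside `Ω` are irrelevant. -/
def IsL2Loc {n : ℕ} (Ω : Opens (Rn n)) (f : Rn n → ℂ) : Prop :=
  ∀ K : Set (Rn n), IsCompact K → K ⊆ Ω → MemLp f 2 (volume.restrict K)

/-- Weak convergence in `L²_loc(Ω)`, i.e. weak convergence in `L²(K)` for each compact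
`K ⊆ Ω`. -/
def WeakTendstoL2Loc {n : ℕ} (Ω : Opens (Rn n)) (f : ℕ → Rn n → ℂ) (g : Rn n → ℂ) : Prop :=
  ∀ K : Set (Rn n), IsCompact K → K ⊆ Ω → ∀ h : Rn n → ℂ, MemLp h 2 (volume.restrict K) →
    Tendsto (fun r => ∫ x in K, f r x * h x) atTop (𝓝 (∫ x in K, g x * h x))

/-- Precompactness in the Fréchet space `L²_loc(Ω)` of a sequence: each subsequence has a
further subsequence that converges in `L²_loc(Ω)`, i.e. in `L²(K)` for each compact `K ⊆ Ω`. -/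
def PrecompactL2Loc {n : ℕ} (Ω : Opens (Rn n)) (f : ℕ → Rn n → ℂ) : Prop :=
  ∀ σ : ℕ → ℕ, StrictMono σ → ∃ τ : ℕ → ℕ, StrictMono τ ∧ ∃ g : Rn n → ℂ, IsL2Loc Ω g ∧
    ∀ K : Set (Rn n), IsCompact K → K ⊆ Ω →
      Tendsto (fun j => eLpNorm (fun x => f (σ (τ j)) x - g x) 2 (volume.restrict K))
        atTop (𝓝 0)

lemma memLp_testFunction_mul {n : ℕ} {Ω : Opens (Rn n)} (Φ : 𝓓(Ω, ℂ)) {f : Rn n → ℂ}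
    (hf : IsL2Loc Ω f) : MemLp (fun x => Φ x * f x) 2 (volume : Measure (Rn n)) := by
  have hK : IsCompact (tsupport Φ) := Φ.hasCompactSupport
  have h1 : MemLp (fun x => Φ x * f x) 2 (volume.restrict (tsupport Φ)) :=
    MemLp.mul (r := 2) (hf _ hK Φ.tsupport_subset)
      ((Φ.continuous.memLp_top_of_hasCompactSupport Φ.hasCompactSupport volume).restrict _)
  rw [← memLp_indicator_iff_restrict hK.measurableSet] at h1
  have h2 : (fun x => Φ x * f x) = (tsupport Φ).indicator (fun x => Φ x * f x) := by
    funext x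
    by_cases hx : x ∈ tsupport Φ
    · simp [hx]
    · simp [hx, image_eq_zero_of_notMem_tsupport hx]
  rw [h2]
  exact h1

/-- The product `Φ f ∈ L²(ℝⁿ)` of `Φ ∈ C₀^∞(Ω)` and `f ∈ L²_loc(Ω)`, extended by zero. -/
def cutoff {n : ℕ} {Ω : Opens (Rn n)} (Φ : 𝓓(Ω, ℂ)) {f : Rn n → ℂ} (hf : IsL2Loc Ω f) :
    L2 n :=
  (memLp_testFunction_mul Φ hf).toLp

/-- The set `Λ(x)` of those `λ ∈ ℂᴺ` for which there is an `η ∈ 𝔖` such that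
`∑_{α,k} c_{sαk}(x) p̂_{sαk}(η) λ_α = 0` for all `s`. -/
def characteristicSet {n m N M : ℕ} (c : Fin m → Fin N → Fin M → Rn n → ℂ)
    (p : Fin m → Fin N → Fin M → symbolAlgebra n) (x : Rn n) : Set (Fin N → ℂ) :=
  {l | ∃ η : spectrumS n, ∀ s, ∑ α, ∑ k, c s α k x * gelfand (p s α k) η * l α = 0}

/-- The form `q(u) = ∑_{α,β} q_{αβ} u_α \bar u_β`. This complex number is real when the matrix
is Hermitian, the only case of interest; it is returned as a real number. -/
def hermForm {N : ℕ} (Q : Matrix (Fin N) (Fin N) ℂ) (l : Fin N → ℂ) : ℝ :=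
  (∑ α, ∑ β, Q α β * l α * star (l β)).re

/-- A real locally finite (Radon) measure on `Ω`, possibly of infinite total variation, as a
difference of two positive Borel measures that are finite on the compact subsets of `Ω`. -/
structure LocMeasure {n : ℕ} (Ω : Opens (Rn n)) where
  /-- the measure with the plus sign -/
  pos : Measure (Rn n)
  /-- the measure with the minus sign -/
  neg : Measure (Rn n)
  pos_lt_top : ∀ K : Set (Rn n), IsCompact K → K ⊆ Ω → pos K < ∞
  neg_lt_top : ∀ K : Set (Rn n), IsCompact K → K ⊆ Ω → neg K < ∞

/-- The value of `v` on a relatively compact Borel subset of `Ω`. -/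
def LocMeasure.value {n : ℕ} {Ω : Opens (Rn n)} (v : LocMeasure Ω) (B : Set (Rn n)) : ℝ :=
  v.pos.real B - v.neg.real B

/-- The pairing of `v` with a continuous function with compact support in `Ω`. -/
def LocMeasure.pair {n : ℕ} {Ω : Opens (Rn n)} (v : LocMeasure Ω) (Φ : C_c(Rn n, ℝ)) : ℝ :=
  (∫ x, Φ x ∂v.pos) - ∫ x, Φ x ∂v.neg

/-- Weak convergence in `M_loc(Ω)` of the functions `f r ∈ L¹_loc(Ω)` to `v`: convergence
against all continuous functions with compact support in `Ω`. -/
def WeakTendstoMeasure {n : ℕ} (Ω : Opens (Rn n)) (f : ℕ → Rn n → ℝ) (v : LocMeasure Ω) : Prop :=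
  ∀ Φ : C_c(Rn n, ℝ), tsupport Φ ⊆ Ω →
    Tendsto (fun r => ∫ x, Φ x * f r x) atTop (𝓝 (v.pair Φ))

/-- The inequality `f dx ≤ v` of measures on `Ω`, where `f ∈ L¹_loc(Ω)`: it holds on each Borel
set contained in a compact subset of `Ω`. -/
def DensityLE {n : ℕ} {Ω : Opens (Rn n)} (f : Rn n → ℝ) (v : LocMeasure Ω) : Prop :=
  ∀ B K : Set (Rn n), MeasurableSet B → IsCompact K → B ⊆ K → K ⊆ Ω →
    IntegrableOn f B ∧ ∫ x in B, f x ≤ v.value B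

end AdmissibleSymbols

end

open AdmissibleSymbols

/-! Subtracting the limit leaves `w r = χ (u r - u_lim)`, a weakly null sequence in `L²(ℝⁿ)`. Where
`χ = 1`, expanding the quadratic form shows that `q(u r) - q(w r)` tends weakly to `q(u_lim)`, so it
suffices that `∫ Φ q(x, w r)` is asymptotically nonnegative for each test function `Φ ≥ 0`.

With constant coefficients this is a statement about large frequencies. An ultrafilter that contains
the complements of compact sets and the sets of full measure evaluates symbols by their limits,
hence is a point of `𝔖` (`exists_spectrum_tendsto`). Nonnegativity of `q` on the kernels over `𝔖`
therefore yields, by compactness of the unit sphere, `q(l) + δ|l|² + C|p(ξ)l|² ≥ 0` for almost every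
`ξ` off a compact set (`exists_eventually_hermForm_nonneg`). Plancherel's identity turns this into a
lower bound for `∫ q(V)` (`exists_integral_hermForm_ge`); its frequencies in a compact set are
harmless by `WeakNull.tendsto_setIntegral_fourier`.

Variable coefficients are frozen at a point. Compact commutators map `w r` to strongly null
sequences, so cutoffs pass through the operators, and continuity of the coefficients makes the
remaining error a small multiple of the norm of the cutoff sequence
(`exists_isOpen_integral_hermForm_ge`). A partition of unity adds up these local bounds
(`eventually_integral_mul_hermForm_ge`), and regularity of measures passes from test functions to
Borel sets (`densityLE_of_forall_integral_le`). -/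

noncomputable section

namespace AdmissibleSymbols

/-! ### Weakly null sequences in a Hilbert space. -/

section WeakNull

variable {H : Type*} [NormedAddCommGroup H] [InnerProductSpace ℂ H]

/-- Weak convergence to zero in a Hilbert space. -/
def WeakNull (w : ℕ → H) : Prop := ∀ y, Tendsto (fun r => inner ℂ y (w r)) atTop (𝓝 0)

lemma WeakNull.comp_strictMono {w : ℕ → H} (hw : WeakNull w) {σ : ℕ → ℕ} (hσ : StrictMono σ) :
    WeakNull (w ∘ σ) := fun y => (hw y).comp hσ.tendsto_atTop

lemma WeakNull.sum {ι : Type*} (s : Finset ι) {w : ι → ℕ → H} (hw : ∀ i, WeakNull (w i)) :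
    WeakNull (fun r => ∑ i ∈ s, w i r) := fun y => by
  simpa [inner_sum] using tendsto_finsetSum s fun i _ => hw i y

lemma WeakNull.eq_zero_of_tendsto {w : ℕ → H} (hw : WeakNull w) {g : H}
    (hg : Tendsto w atTop (𝓝 g)) : g = 0 := by
  have h : Tendsto (fun r => inner ℂ g (w r)) atTop (𝓝 (inner ℂ g g)) :=
    tendsto_const_nhds.inner hg
  exact inner_self_eq_zero.1 (tendsto_nhds_unique h (hw g))

/-- A strong limit of a subsequence is also its weak limit, hence zero; precompactness thus upgrades
weak convergence to strong convergence. -/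
lemma WeakNull.tendsto_zero {w : ℕ → H} (hw : WeakNull w)
    (h : ∀ σ : ℕ → ℕ, StrictMono σ → ∃ τ : ℕ → ℕ, StrictMono τ ∧ ∃ g : H,
      Tendsto (fun j => w (σ (τ j))) atTop (𝓝 g)) : Tendsto w atTop (𝓝 0) := by
  refine tendsto_of_subseq_tendsto fun ns hns => ?_
  obtain ⟨ρ, hρ, hρ'⟩ := strictMono_subseq_of_tendsto_atTop hns
  obtain ⟨τ, hτ, g, hg⟩ := h (ns ∘ ρ) hρ'
  have h0 : g = 0 := (hw.comp_strictMono (hρ'.comp hτ)).eq_zero_of_tendsto hg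
  exact ⟨fun j => ρ (τ j), by simpa [h0] using hg⟩

variable [CompleteSpace H]

/-- Uniform boundedness principle for the functionals `⟨w r, ·⟩`. -/
lemma WeakNull.bounded {w : ℕ → H} (hw : WeakNull w) : ∃ C, ∀ r, ‖w r‖ ≤ C := by
  obtain ⟨C, hC⟩ := banach_steinhaus (g := fun r => innerSL ℂ (w r)) fun y => by
    obtain ⟨C, hC⟩ := (hw y).norm.bddAbove_range
    refine ⟨C, fun r => ?_⟩
    rw [innerSL_apply_apply, norm_inner_symm]
    exact hC ⟨r, rfl⟩
  exact ⟨C, fun r => by simpa using hC r⟩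

lemma WeakNull.clm {w : ℕ → H} (hw : WeakNull w) (T : H →L[ℂ] H) :
    WeakNull (fun r => T (w r)) := fun y => by
  simpa [ContinuousLinearMap.adjoint_inner_left] using hw (T.adjoint y)

/-- The bounded sequence `w` is mapped into a compact set, so `WeakNull.tendsto_zero` applies to its
image. This is how the compactness of the commutators is used. -/
lemma WeakNull.compact {w : ℕ → H} (hw : WeakNull w) {T : H →L[ℂ] H}
    (hT : IsCompactOperator T) : Tendsto (fun r => T (w r)) atTop (𝓝 0) := by
  obtain ⟨C, hC⟩ := hw.bounded
  refine (hw.clm T).tendsto_zero fun σ hσ => ?_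
  obtain ⟨K, hK, hKs⟩ := hT.image_closedBall_subset_compact (f := (T : H →ₗ[ℂ] H)) C
  obtain ⟨a, -, φ, hφ, ha⟩ := hK.tendsto_subseq (x := fun j => T (w (σ j)))
    fun j => hKs ⟨w (σ j), by simpa using hC _, rfl⟩
  exact ⟨φ, hφ, a, ha⟩

end WeakNull

/-! ### The Fourier transform of cutoffs at bounded frequencies. -/

section Fourier

open Real

variable {n : ℕ}

/-- On `L¹ ∩ L²` the Fourier transform of `L²` is given by the integral. -/
lemma coeFn_fourier_of_integrable (f : L2 n) (hf : Integrable f) :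
    (𝓕 f : L2 n) =ᵐ[volume] 𝓕 (f : Rn n → ℂ) := by
  have hc : Continuous (𝓕 (f : Rn n → ℂ)) :=
    VectorFourier.fourierIntegral_continuous Real.continuous_fourierChar
      (L := innerₗ (Rn n)) continuous_inner hf
  -- Both sides are tested against a smooth `g` with compact support. The transform moves onto `g`,
  -- on the left through tempered distributions and on the right by Fubini, and both pairings equal
  -- `∫ 𝓕 g · f`.
  refine ae_eq_of_integral_contDiff_smul_eq
    ((Lp.memLp _).locallyIntegrable (by norm_num)) hc.locallyIntegrable fun g hg hgc => ?_
  have hg₁ : HasCompactSupport (Complex.ofRealCLM ∘ g) := hgc.comp_left rfl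
  have hg₂ : ContDiff ℝ (⊤ : ℕ∞) (Complex.ofRealCLM ∘ g) := by fun_prop
  let G := hg₁.toSchwartzMap hg₂
  have h := congrArg (fun d => d G) (Lp.fourier_toTemperedDistribution_eq f)
  simp only [TemperedDistribution.fourier_apply, Lp.toTemperedDistribution_apply] at h
  have h2 := VectorFourier.integral_fourierIntegral_smul_eq_flip (L := innerₗ (Rn n))
      Real.continuous_fourierChar continuous_inner (G.integrable (μ := volume)) hf
  have e1 : ∀ x, G x = (g x : ℂ) := fun x => by simp [G]
  calc ∫ x, g x • (𝓕 f : L2 n) x = ∫ x, G x • (𝓕 f : L2 n) x := by simp [e1]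
    _ = ∫ x, (𝓕 G) x • f x := h.symm
    _ = ∫ x, G x • 𝓕 (f : Rn n → ℂ) x := by
        simpa [SchwartzMap.fourier_coe, flip_innerₗ] using! h2
    _ = _ := by simp [e1]

/-- A bounded measurable function as an element of `L^∞(ℝⁿ)`. -/
def ofBounded (f : Rn n → ℂ) (hf : MemLp f ∞ volume) : Linf n :=
  ⟨(hf.toLp f).1, mem_Linf.2 (hf.toLp f).2⟩

lemma coeFn_mulOp_ofBounded {f : Rn n → ℂ} (hf : MemLp f ∞ volume) (u : L2 n) :
    mulOp (ofBounded f hf) u =ᵐ[volume] fun x => f x * u x := by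
  filter_upwards [coeFn_mulOp (ofBounded f hf) u, hf.coeFn_toLp] with x h1 h2
  rw [h1]
  exact congrArg (· * u x) h2

lemma coeFn_mulOp_ofCc (Φ : C_c(Rn n, ℂ)) (u : L2 n) :
    mulOp (ofCc Φ) u =ᵐ[volume] fun x => Φ x * u x :=
  coeFn_mulOp_ofBounded (Φ.continuous.memLp_top_of_hasCompactSupport Φ.hasCompactSupport volume) u

lemma integrable_mulOp_ofCc (Φ : C_c(Rn n, ℂ)) (u : L2 n) : Integrable (mulOp (ofCc Φ) u) := by
  rw [integrable_congr (coeFn_mulOp_ofCc Φ u)]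
  exact (Φ.continuous.memLp_of_hasCompactSupport Φ.hasCompactSupport (p := 2)).integrable_mul
    (Lp.memLp u)

/-- Cutoffs of a weakly null sequence tend to zero in `L²` on bounded sets of frequencies. -/
lemma WeakNull.tendsto_setIntegral_fourier {w : ℕ → L2 n} (hw : WeakNull w) (Φ : C_c(Rn n, ℂ))
    {T : Set (Rn n)} (hT : IsCompact T) :
    Tendsto (fun r => ∫ ξ in T, ‖(𝓕 (mulOp (ofCc Φ) (w r)) : L2 n) ξ‖ ^ 2) atTop (𝓝 0) := by
  have hΦ : MemLp Φ 2 (volume : Measure (Rn n)) :=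
    Φ.continuous.memLp_of_hasCompactSupport Φ.hasCompactSupport
  -- The integral defining the transform of `Φ u` at `ξ` is an inner product of `u` with a vector `y
  -- ξ` whose norm is at most that of `Φ`. Weak convergence thus gives pointwise convergence, and
  -- boundedness of `w` a constant majorant on the finite-measure set `T`.
  have hy (ξ : Rn n) : MemLp (fun x => star (𝐞 (-inner ℝ x ξ) • Φ x)) 2 volume := by
    refine (MemLp.of_le hΦ ?_ (ae_of_all _ fun x => by simp)).star
    exact Continuous.aestronglyMeasurable (by fun_prop)
  let y (ξ : Rn n) : L2 n := (hy ξ).toLp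
  have hyn (ξ : Rn n) : ‖y ξ‖ ≤ ‖hΦ.toLp‖ := by
    refine Lp.norm_le_norm_of_ae_le ?_
    filter_upwards [(hy ξ).coeFn_toLp, hΦ.coeFn_toLp] with x h1 h2
    rw [h1, h2]
    simp
  have hin (u : L2 n) (ξ : Rn n) :
      𝓕 (mulOp (ofCc Φ) u : Rn n → ℂ) ξ = inner ℂ (y ξ) u := by
    rw [Real.fourier_eq, L2.inner_def]
    refine integral_congr_ae ?_
    filter_upwards [(hy ξ).coeFn_toLp, coeFn_mulOp_ofCc Φ u] with x h1 h2
    rw [h1, h2]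
    simp [RCLike.inner_apply, Circle.smul_def]
    ring
  obtain ⟨C, hC⟩ := hw.bounded
  have hC0 : 0 ≤ C := (norm_nonneg _).trans (hC 0)
  have hfin : IsFiniteMeasure (volume.restrict T) := ⟨by simpa using hT.measure_lt_top⟩
  have hlim := tendsto_integral_of_dominated_convergence (μ := volume.restrict T)
    (F := fun r ξ => ‖(𝓕 (mulOp (ofCc Φ) (w r)) : L2 n) ξ‖ ^ 2) (f := fun _ => (0 : ℝ))
    (fun _ => (‖hΦ.toLp‖ * C) ^ 2)
    (fun r => ((Lp.aestronglyMeasurable _).norm.pow 2).restrict) (integrable_const _)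
    (fun r => by
      filter_upwards [ae_restrict_of_ae (coeFn_fourier_of_integrable _
        (integrable_mulOp_ofCc Φ (w r)))] with ξ h
      rw [h, hin, norm_pow, norm_norm]
      gcongr
      exact (norm_inner_le_norm _ _).trans (by gcongr; exacts [hyn ξ, hC r]))
    (by
      have h : ∀ᵐ ξ ∂(volume.restrict T), ∀ r, (𝓕 (mulOp (ofCc Φ) (w r)) : L2 n) ξ
          = 𝓕 (mulOp (ofCc Φ) (w r) : Rn n → ℂ) ξ := ae_all_iff.2 fun r =>
        ae_restrict_of_ae (coeFn_fourier_of_integrable _ (integrable_mulOp_ofCc Φ (w r)))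
      filter_upwards [h] with ξ h
      simp only [h, hin]
      simpa using ((hw (y ξ)).norm).pow 2)
  simpa using hlim

end Fourier

/-! ### Points of the spectrum from ultrafilters at infinity. -/

section Spectrum

variable {n : ℕ}

lemma exists_ae_norm_le (ψ : Linf n) : ∃ M : ℝ, ∀ᵐ x ∂(volume : Measure (Rn n)), ‖ψ.1 x‖ ≤ M := by
  have hf := (Lp.mem_Lp_iff_memLp.1 (mem_Linf.1 ψ.2)).eLpNorm_ne_top
  refine ⟨(eLpNorm ψ.1 ∞ volume).toReal, ?_⟩
  rw [eLpNorm_exponent_top] at hf ⊢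
  filter_upwards [ae_le_eLpNormEssSup (f := ψ.1) (μ := (volume : Measure (Rn n)))] with x hx
  rw [← toReal_enorm]
  exact ENNReal.toReal_mono hf hx

/-- The limit along an ultrafilter at infinity, finer than the filter of sets of full measure, is
a point of the spectrum. -/
lemma exists_spectrum_tendsto (𝒰 : Ultrafilter (Rn n))
    (h𝒰 : (𝒰 : Filter (Rn n)) ≤ cocompact (Rn n) ⊓ ae volume) :
    ∃ η : spectrumS n, ∀ ψ : symbolAlgebra n,
      Tendsto (ψ.1.1 : Rn n → ℂ) 𝒰 (𝓝 (gelfand ψ η)) := by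
  have hae : (𝒰 : Filter (Rn n)) ≤ ae volume := h𝒰.trans inf_le_right
  -- Almost all values of `ψ` lie in a compact ball, where every ultrafilter converges.
  have hex (ψ : symbolAlgebra n) : ∃ a, Tendsto (ψ.1.1 : Rn n → ℂ) 𝒰 (𝓝 a) := by
    obtain ⟨M, hM⟩ := exists_ae_norm_le ψ.1
    have h : Metric.closedBall (0 : ℂ) M ∈ 𝒰.map (ψ.1.1 : Rn n → ℂ) :=
      by
      rw [Ultrafilter.mem_map]
      exact hae (by filter_upwards [hM] with x hx; simpa using hx)
    obtain ⟨a, -, ha⟩ := (isCompact_closedBall (0 : ℂ) M).ultrafilter_le_nhds' _ h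
    exact ⟨a, ha⟩
  choose L hL using hex
  have huniq {ψ : symbolAlgebra n} {a : ℂ} (h : Tendsto (ψ.1.1 : Rn n → ℂ) 𝒰 (𝓝 a)) : L ψ = a :=
    tendsto_nhds_unique (hL ψ) h
  have hC (c : ℂ) : L (algebraMap ℂ _ c) = c := huniq <|
    Tendsto.congr' ((coeFn_algebraMap (n := n) c).filter_mono hae).symm tendsto_const_nhds
  let L' : symbolAlgebra n →ₐ[ℂ] ℂ :=
    { toFun := L
      map_one' := by simpa using hC 1
      map_zero' := by simpa using hC 0
      map_mul' := fun ψ φ => huniq <|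
        Tendsto.congr' ((AEEqFun.coeFn_mul ψ.1.1 φ.1.1).filter_mono hae).symm ((hL ψ).mul (hL φ))
      map_add' := fun ψ φ => huniq <|
        Tendsto.congr' ((AEEqFun.coeFn_add ψ.1.1 φ.1.1).filter_mono hae).symm ((hL ψ).add (hL φ))
      commutes' := hC }
  refine ⟨Ideal.Quotient.liftₐ (vanishingIdeal n) L' fun ψ hψ => huniq (Tendsto.mono_left hψ h𝒰),
    fun ψ => ?_⟩
  exact hL ψ

end Spectrum

/-! ### Pointwise bounds for forms at large frequencies. -/

section HermForm

variable {N : ℕ}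

lemma continuous_hermForm (Q : Matrix (Fin N) (Fin N) ℂ) : Continuous (hermForm Q) := by
  unfold hermForm
  fun_prop

lemma hermForm_smul (Q : Matrix (Fin N) (Fin N) ℂ) (t : ℝ) (l : Fin N → ℂ) :
    hermForm Q (fun α => t * l α) = t ^ 2 * hermForm Q l := by
  unfold hermForm
  rw [← Complex.re_ofReal_mul, Finset.mul_sum]
  congr 1
  refine Finset.sum_congr rfl fun α _ => ?_
  rw [Finset.mul_sum]
  refine Finset.sum_congr rfl fun β _ => ?_
  simp
  ring

lemma hermForm_sub (Q R : Matrix (Fin N) (Fin N) ℂ) (l : Fin N → ℂ) :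
    hermForm (Q - R) l = hermForm Q l - hermForm R l := by
  simp [hermForm, sub_mul, Finset.sum_sub_distrib]

lemma abs_hermForm_le (Q : Matrix (Fin N) (Fin N) ℂ) (l : Fin N → ℂ) :
    |hermForm Q l| ≤ (∑ α, ∑ β, ‖Q α β‖) * ∑ α, ‖l α‖ ^ 2 := by
  refine (Complex.abs_re_le_norm _).trans ?_
  rw [Finset.sum_mul]
  refine norm_sum_le_of_le _ fun α _ => ?_
  rw [Finset.sum_mul]
  refine norm_sum_le_of_le _ fun β _ => ?_
  rw [norm_mul, norm_mul, norm_star, mul_assoc]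
  gcongr
  have h (γ : Fin N) : ‖l γ‖ ^ 2 ≤ ∑ γ, ‖l γ‖ ^ 2 :=
    Finset.single_le_sum (f := fun γ => ‖l γ‖ ^ 2) (fun _ _ => by positivity) (Finset.mem_univ γ)
  nlinarith [h α, h β, sq_nonneg (‖l α‖ - ‖l β‖)]

lemma isCompact_sphere_sum_sq : IsCompact {l : Fin N → ℂ | ∑ α, ‖l α‖ ^ 2 = 1} := by
  refine Metric.isCompact_of_isClosed_isBounded (isClosed_eq (by fun_prop) continuous_const) ?_
  refine (Metric.isBounded_closedBall (x := (0 : Fin N → ℂ)) (r := 1)).subset fun l hl => ?_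
  rw [mem_closedBall_zero_iff, pi_norm_le_iff_of_nonneg zero_le_one]
  intro γ
  have h : ‖l γ‖ ^ 2 ≤ ∑ γ, ‖l γ‖ ^ 2 :=
    Finset.single_le_sum (f := fun γ => ‖l γ‖ ^ 2) (fun _ _ => by positivity) (Finset.mem_univ γ)
  rw [Set.mem_ofPred_eq] at hl
  nlinarith [norm_nonneg (l γ)]

/-- If a form is nonnegative on the common kernels of the values of the symbols at the points of
the spectrum, then it is nonnegative for large frequencies up to a small error and a multiple of
the squares of the symbols. -/
lemma exists_eventually_hermForm_nonneg {n m : ℕ} (f : Fin m → Fin N → symbolAlgebra n)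
    (Q : Matrix (Fin N) (Fin N) ℂ)
    (hQ : ∀ (η : spectrumS n) (l : Fin N → ℂ), (∀ s, ∑ α, gelfand (f s α) η * l α = 0) →
      0 ≤ hermForm Q l) {δ : ℝ} (hδ : 0 < δ) :
    ∃ C : ℝ, 0 ≤ C ∧ ∀ᶠ ξ in cocompact (Rn n) ⊓ ae volume, ∀ l : Fin N → ℂ,
      0 ≤ hermForm Q l + δ * ∑ α, ‖l α‖ ^ 2 + C * ∑ s, ‖∑ α, (f s α).1.1 ξ * l α‖ ^ 2 := by
  -- The unit vectors at which the term `δ |l|²` may fail to compensate a negative value of the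
  -- form.
  set S : Set (Fin N → ℂ) := {l | ∑ α, ‖l α‖ ^ 2 = 1} ∩ {l | hermForm Q l ≤ -δ} with hS_def
  have hS : IsCompact S :=
    isCompact_sphere_sum_sq.inter_right (isClosed_le (continuous_hermForm Q) continuous_const)
  set F : Rn n × (Fin N → ℂ) → ℝ := fun z => ∑ s, ‖∑ α, (f s α).1.1 z.1 * z.2 α‖ ^ 2 with hF
  have hF0 (z) : 0 ≤ F z := by positivity
  have key : ∃ ε : ℝ, 0 < ε ∧ ∀ᶠ z in (cocompact (Rn n) ⊓ ae volume) ×ˢ 𝓟 S, ε ≤ F z := by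
    -- Otherwise `F` tends to zero along some ultrafilter on pairs `(ξ, l)`. Its frequency component
    -- defines a point `η` of the spectrum, its vector component converges to some `l` in `S`, and
    -- `l` lies in the kernel at `η` although the form is at most `-δ < 0` there.
    by_contra! hcon
    have hcl : MapClusterPt 0 ((cocompact (Rn n) ⊓ ae volume) ×ˢ 𝓟 S) F := by
      refine mapClusterPt_iff_frequently.2 fun V hV => ?_
      obtain ⟨ε, hε, hεV⟩ := Metric.mem_nhds_iff.1 hV
      refine (hcon ε hε).mono fun z hz => hεV ?_
      rwa [mem_ball_zero_iff, Real.norm_of_nonneg (hF0 z)]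
    obtain ⟨𝒱, h𝒱, hlim⟩ := mapClusterPt_iff_ultrafilter.1 hcl
    obtain ⟨η, hη⟩ := exists_spectrum_tendsto (𝒱.map Prod.fst)
      ((map_mono h𝒱).trans tendsto_fst)
    obtain ⟨l, hlS, hl⟩ := hS.ultrafilter_le_nhds (𝒱.map Prod.snd)
      ((map_mono h𝒱).trans tendsto_snd)
    have hl' : Tendsto Prod.snd (𝒱 : Filter (Rn n × (Fin N → ℂ))) (𝓝 l) := hl
    have hlim' : Tendsto F 𝒱 (𝓝 (∑ s, ‖∑ α, gelfand (f s α) η * l α‖ ^ 2)) := by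
      refine tendsto_finsetSum _ fun s _ => ((tendsto_finsetSum _ fun α _ => ?_).norm).pow 2
      exact (tendsto_map'_iff.1 (hη (f s α))).mul (tendsto_pi_nhds.1 hl' α)
    have h0 := tendsto_nhds_unique hlim' hlim
    rw [Finset.sum_eq_zero_iff_of_nonneg fun _ _ => by positivity] at h0
    have h1 := hQ η l fun s => by simpa using h0 s (Finset.mem_univ s)
    linarith [show hermForm Q l ≤ -δ from hlS.2]
  obtain ⟨ε, hε, hev⟩ := key
  set B : ℝ := ∑ α, ∑ β, ‖Q α β‖
  have hB : 0 ≤ B := by positivity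
  -- On `S` the sum of squares is at least `ε`, so this multiple of it is at least `B`, which bounds
  -- the form on unit vectors.
  refine ⟨B / ε, by positivity, ?_⟩
  rw [eventually_prod_principal_iff] at hev
  filter_upwards [hev] with ξ hξ l
  have hunit (l : Fin N → ℂ) (hl : ∑ α, ‖l α‖ ^ 2 = 1) :
      0 ≤ hermForm Q l + δ + B / ε * ∑ s, ‖∑ α, (f s α).1.1 ξ * l α‖ ^ 2 := by
    have h0 : 0 ≤ ∑ s, ‖∑ α, (f s α).1.1 ξ * l α‖ ^ 2 := by positivity
    by_cases hlS : hermForm Q l ≤ -δ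
    · have h1 : ε ≤ ∑ s, ‖∑ α, (f s α).1.1 ξ * l α‖ ^ 2 := hξ l ⟨hl, hlS⟩
      have h2 : B ≤ B / ε * ∑ s, ‖∑ α, (f s α).1.1 ξ * l α‖ ^ 2 :=
        calc B = B / ε * ε := by field_simp
          _ ≤ _ := by gcongr
      have h3 := (abs_le.1 (abs_hermForm_le Q l)).1
      rw [hl, mul_one] at h3
      linarith
    · have : 0 ≤ B / ε * ∑ s, ‖∑ α, (f s α).1.1 ξ * l α‖ ^ 2 := by positivity
      linarith
  have ht0 : 0 ≤ ∑ α, ‖l α‖ ^ 2 := by positivity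
  -- All terms are homogeneous of degree two, so a nonzero `l` reduces to a unit vector.
  rcases ht0.eq_or_lt with h | h
  · have hl : l = 0 := by
      rw [eq_comm, Finset.sum_eq_zero_iff_of_nonneg fun _ _ => by positivity] at h
      funext α
      simpa using h α (Finset.mem_univ α)
    simp [hl, hermForm]
  · set t : ℝ := √(∑ α, ‖l α‖ ^ 2)
    have ht : 0 < t := Real.sqrt_pos.2 h
    have ht2 : t ^ 2 = ∑ α, ‖l α‖ ^ 2 := Real.sq_sqrt ht0
    have hle : l = fun α => (t : ℂ) * (((t⁻¹ : ℝ) : ℂ) * l α) := by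
      funext α
      have : (t : ℂ) ≠ 0 := by exact_mod_cast ht.ne'
      push_cast
      field_simp
    have h1 := hunit (fun α => ((t⁻¹ : ℝ) : ℂ) * l α) (by
      simp only [norm_mul, mul_pow, ← Finset.mul_sum, ← ht2]
      simp [ht.ne'])
    have h2 (s : Fin m) : ‖∑ α, (f s α).1.1 ξ * l α‖ ^ 2
        = t ^ 2 * ‖∑ α, (f s α).1.1 ξ * (((t⁻¹ : ℝ) : ℂ) * l α)‖ ^ 2 := by
      have h3 : ∑ α, (f s α).1.1 ξ * l α
          = (t : ℂ) * ∑ α, (f s α).1.1 ξ * (((t⁻¹ : ℝ) : ℂ) * l α) := by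
        rw [Finset.mul_sum]
        refine Finset.sum_congr rfl fun α _ => ?_
        exact (congrArg (fun z => (f s α).1.1 ξ * z) (congrFun hle α)).trans (by ring)
      rw [h3, norm_mul, mul_pow, Complex.norm_real, Real.norm_of_nonneg ht.le]
    simp only [h2, ← Finset.mul_sum, ← ht2]
    nth_rw 1 [hle]
    rw [hermForm_smul]
    nlinarith [mul_nonneg (sq_nonneg t) h1]

end HermForm

/-! ### Plancherel's identity and forms with constant coefficients. -/

section

variable {n N : ℕ}

lemma integrable_norm_sq (u : L2 n) : Integrable (fun x => ‖u x‖ ^ 2) :=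
  (memLp_two_iff_integrable_sq_norm (Lp.aestronglyMeasurable u)).1 (Lp.memLp u)

lemma integral_norm_sq (u : L2 n) : ∫ x, ‖u x‖ ^ 2 = ‖u‖ ^ 2 := by
  have h : inner ℂ u u = ((‖u‖ ^ 2 : ℝ) : ℂ) := by
    rw [inner_self_eq_norm_sq_to_K]; simp
  rw [L2.inner_def] at h
  simp only [inner_self_eq_norm_sq_to_K] at h
  have h2 : ((∫ x, ‖u x‖ ^ 2 : ℝ) : ℂ) = ((‖u‖ ^ 2 : ℝ) : ℂ) := by
    rw [← h, ← integral_complex_ofReal]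
    simp
  exact_mod_cast h2

lemma integrable_sesq (Q : Matrix (Fin N) (Fin N) ℂ) (V : Fin N → L2 n) :
    Integrable (fun x => ∑ α, ∑ β, Q α β * V α x * star (V β x)) := by
  refine integrable_finsetSum _ fun α _ => integrable_finsetSum _ fun β _ => ?_
  have h := (L2.integrable_inner (𝕜 := ℂ) (V β) (V α)).const_mul (Q α β)
  refine h.congr (ae_of_all _ fun x => ?_)
  simp [RCLike.inner_apply, mul_assoc]

lemma integrable_hermForm (Q : Matrix (Fin N) (Fin N) ℂ) (V : Fin N → L2 n) :
    Integrable (fun x => hermForm Q fun α => V α x) :=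
  (integrable_sesq Q V).re

lemma integral_hermForm (Q : Matrix (Fin N) (Fin N) ℂ) (V : Fin N → L2 n) :
    ∫ x, hermForm Q (fun α => V α x) = (∑ α, ∑ β, Q α β * inner ℂ (V β) (V α)).re := by
  have h : ∫ x, ∑ α, ∑ β, Q α β * V α x * star (V β x)
      = ∑ α, ∑ β, Q α β * inner ℂ (V β) (V α) := by
    have hi (α β : Fin N) : Integrable (fun x => Q α β * V α x * star (V β x)) := by
      refine ((L2.integrable_inner (𝕜 := ℂ) (V β) (V α)).const_mul (Q α β)).congr
        (ae_of_all _ fun x => ?_)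
      simp [RCLike.inner_apply, mul_assoc]
    rw [integral_finsetSum _ fun α _ => integrable_finsetSum _ fun β _ => hi α β]
    refine Finset.sum_congr rfl fun α _ => ?_
    rw [integral_finsetSum _ fun β _ => hi α β]
    refine Finset.sum_congr rfl fun β _ => ?_
    rw [L2.inner_def, ← integral_const_mul]
    refine integral_congr_ae (ae_of_all _ fun x => ?_)
    simp [RCLike.inner_apply, mul_assoc]
  rw [← h]
  exact integral_re (𝕜 := ℂ) (integrable_sesq Q V)

/-- Plancherel's identity for forms with constant coefficients. -/
lemma integral_hermForm_fourier (Q : Matrix (Fin N) (Fin N) ℂ) (V : Fin N → L2 n) :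
    ∫ ξ, hermForm Q (fun α => (𝓕 (V α) : L2 n) ξ) = ∫ x, hermForm Q (fun α => V α x) := by
  rw [integral_hermForm, integral_hermForm]
  simp only [Lp.inner_fourier_eq]

lemma fourier_symbolOp (ψ : Linf n) (u : L2 n) : 𝓕 (symbolOp ψ u) = mulOp ψ (𝓕 u) :=
  (Lp.fourierTransformₗᵢ (Rn n) ℂ).apply_symm_apply _

lemma coeFn_sum_mulOp {ι : Type*} [Fintype ι] (ψ : ι → Linf n) (u : ι → L2 n) :
    (∑ i, mulOp (ψ i) (u i) : L2 n) =ᵐ[volume] fun x => ∑ i, (ψ i).1 x * u i x := by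
  filter_upwards [Lp.coeFn_finsetSum Finset.univ fun i => mulOp (ψ i) (u i),
    ae_all_iff.2 fun i => coeFn_mulOp (ψ i) (u i)] with x h1 h2
  rw [h1, Finset.sum_apply]
  exact Finset.sum_congr rfl fun i _ => h2 i

lemma norm_sq_sum_symbolOp {ι : Type*} [Fintype ι] (ψ : ι → Linf n) (u : ι → L2 n) :
    ‖∑ i, symbolOp (ψ i) (u i)‖ ^ 2 = ∫ ξ, ‖∑ i, (ψ i).1 ξ * (𝓕 (u i) : L2 n) ξ‖ ^ 2 := by
  have h : 𝓕 (∑ i, symbolOp (ψ i) (u i)) = ∑ i, mulOp (ψ i) (𝓕 (u i)) := by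
    simp only [← fourier_symbolOp]
    exact map_sum (Lp.fourierTransformₗᵢ (Rn n) ℂ) _ _
  rw [← Lp.norm_fourier_eq, h, ← integral_norm_sq]
  refine integral_congr_ae ?_
  filter_upwards [coeFn_sum_mulOp ψ fun i => 𝓕 (u i)] with x hx
  rw [hx]

lemma integrable_norm_sq_sum {ι : Type*} [Fintype ι] (ψ : ι → Linf n) (u : ι → L2 n) :
    Integrable (fun ξ => ‖∑ i, (ψ i).1 ξ * u i ξ‖ ^ 2) := by
  refine (integrable_norm_sq (∑ i, mulOp (ψ i) (u i))).congr ?_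
  filter_upwards [coeFn_sum_mulOp ψ u] with x hx
  rw [hx]

/-- The lower bound of the integral of a form with constant coefficients by the operators whose
symbols control it for large frequencies. -/
lemma exists_integral_hermForm_ge {m : ℕ} (f : Fin m → Fin N → symbolAlgebra n)
    (Q : Matrix (Fin N) (Fin N) ℂ)
    (hQ : ∀ (η : spectrumS n) (l : Fin N → ℂ), (∀ s, ∑ α, gelfand (f s α) η * l α = 0) →
      0 ≤ hermForm Q l) {δ : ℝ} (hδ : 0 < δ) :
    ∃ C : ℝ, 0 ≤ C ∧ ∃ T : Set (Rn n), IsCompact T ∧ ∀ V : Fin N → L2 n,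
      -δ * ∑ α, ‖V α‖ ^ 2 - C * ∑ s, ‖∑ α, symbolOp (f s α).1 (V α)‖ ^ 2
        - C * ∑ α, ∫ ξ in T, ‖(𝓕 (V α) : L2 n) ξ‖ ^ 2 ≤ ∫ x, hermForm Q (fun α => V α x) := by
  obtain ⟨C₁, hC₁, hev⟩ := exists_eventually_hermForm_nonneg f Q hQ hδ
  obtain ⟨A, hA, B, hB, hAB⟩ := mem_inf_iff_superset.1 hev
  obtain ⟨T, hT, hTA⟩ := mem_cocompact.1 hA
  set C₂ : ℝ := ∑ α, ∑ β, ‖Q α β‖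
  have hC₂ : 0 ≤ C₂ := by positivity
  -- Off `T` the bound at large frequencies applies with `C₁`; on `T` the crude bound of the form by
  -- `C₂` is absorbed by the last term.
  refine ⟨max C₁ C₂, le_max_of_le_left hC₁, T, hT, fun V => ?_⟩
  set D := max C₁ C₂
  let W (α : Fin N) : L2 n := 𝓕 (V α)
  have hpt : ∀ᵐ ξ ∂(volume : Measure (Rn n)),
      -δ * ∑ α, ‖W α ξ‖ ^ 2 - D * ∑ s, ‖∑ α, (f s α).1.1 ξ * W α ξ‖ ^ 2
        - D * ∑ α, T.indicator (fun ξ => ‖W α ξ‖ ^ 2) ξ ≤ hermForm Q (fun α => W α ξ) := by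
    filter_upwards [hB] with ξ hξB
    have p1 : 0 ≤ ∑ α, ‖W α ξ‖ ^ 2 := by positivity
    have p2 : 0 ≤ ∑ s, ‖∑ α, (f s α).1.1 ξ * W α ξ‖ ^ 2 := by positivity
    by_cases hξ : ξ ∈ T
    · simp only [Set.indicator_of_mem hξ]
      have h1 := (abs_le.1 (abs_hermForm_le Q fun α => W α ξ)).1
      have h2 : C₂ * ∑ α, ‖W α ξ‖ ^ 2 ≤ D * ∑ α, ‖W α ξ‖ ^ 2 := by gcongr; exact le_max_right _ _
      have h3 : 0 ≤ D * ∑ s, ‖∑ α, (f s α).1.1 ξ * W α ξ‖ ^ 2 :=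
        mul_nonneg (le_max_of_le_left hC₁) p2
      have h4 : 0 ≤ δ * ∑ α, ‖W α ξ‖ ^ 2 := by positivity
      linarith
    · simp only [Set.indicator_of_notMem hξ]
      have h1 := hAB ⟨hTA hξ, hξB⟩ (fun α => W α ξ)
      have h2 : C₁ * ∑ s, ‖∑ α, (f s α).1.1 ξ * W α ξ‖ ^ 2
          ≤ D * ∑ s, ‖∑ α, (f s α).1.1 ξ * W α ξ‖ ^ 2 := by gcongr; exact le_max_left _ _
      simp only [Finset.sum_const_zero, mul_zero]
      linarith
  have i1 : Integrable (fun ξ => ∑ α, ‖W α ξ‖ ^ 2) :=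
    integrable_finsetSum _ fun α _ => integrable_norm_sq (W α)
  have i2 : Integrable (fun ξ => ∑ s, ‖∑ α, (f s α).1.1 ξ * W α ξ‖ ^ 2) :=
    integrable_finsetSum _ fun s _ => integrable_norm_sq_sum (fun α => (f s α).1) W
  have i3 : Integrable (fun ξ => ∑ α, T.indicator (fun ξ => ‖W α ξ‖ ^ 2) ξ) :=
    integrable_finsetSum _ fun α _ => (integrable_norm_sq (W α)).indicator hT.measurableSet
  have i4 : Integrable (fun ξ => -δ * ∑ α, ‖W α ξ‖ ^ 2
      - D * ∑ s, ‖∑ α, (f s α).1.1 ξ * W α ξ‖ ^ 2) := (i1.const_mul (-δ)).sub (i2.const_mul D)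
  have h := integral_mono_ae (i4.sub (i3.const_mul D)) (integrable_hermForm Q W) hpt
  rw [integral_hermForm_fourier] at h
  refine le_trans (le_of_eq ?_) h
  simp only [Pi.sub_apply]
  rw [integral_sub i4 (i3.const_mul D),
    integral_sub (i1.const_mul (-δ)) (i2.const_mul D), integral_const_mul, integral_const_mul,
    integral_const_mul, integral_finsetSum _ fun α _ => integrable_norm_sq (W α),
    integral_finsetSum _ fun s _ => integrable_norm_sq_sum (fun α => (f s α).1) W,
    integral_finsetSum _ fun α _ => (integrable_norm_sq (W α)).indicator hT.measurableSet]
  simp only [integral_norm_sq, integral_indicator hT.measurableSet, norm_sq_sum_symbolOp, W,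
    Lp.norm_fourier_eq]

end

/-! ### Cutoffs, commutators and freezing of the constraints. -/

section

variable {n N : ℕ}

lemma memLp_indicator_of_continuousOn {K : Set (Rn n)} (hK : IsCompact K) {g : Rn n → ℂ}
    (hg : ContinuousOn g K) : MemLp (K.indicator g) ∞ volume := by
  obtain ⟨C, hC⟩ := hK.exists_bound_of_continuousOn hg
  rw [memLp_indicator_iff_restrict hK.measurableSet]
  exact memLp_top_of_bound (hg.aestronglyMeasurable hK.measurableSet) C
    ((ae_restrict_iff' hK.measurableSet).2 (ae_of_all _ hC))

/-- A function that is continuous on a compact set, extended by zero, as an element of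
`L^∞(ℝⁿ)`. -/
def cutSymbol {K : Set (Rn n)} (hK : IsCompact K) {g : Rn n → ℂ} (hg : ContinuousOn g K) :
    Linf n :=
  ofBounded (K.indicator g) (memLp_indicator_of_continuousOn hK hg)

lemma coeFn_mulOp_cutSymbol {K : Set (Rn n)} (hK : IsCompact K) {g : Rn n → ℂ}
    (hg : ContinuousOn g K) (u : L2 n) :
    mulOp (cutSymbol hK hg) u =ᵐ[volume] fun x => K.indicator g x * u x :=
  coeFn_mulOp_ofBounded _ u

lemma symbolOp_smul (a : ℂ) (ψ : Linf n) : symbolOp (a • ψ) = a • symbolOp ψ := by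
  rw [Algebra.smul_def, symbolOp_mul, symbolOp_algebraMap]
  ext1 u
  simp

lemma symbolOp_sum {ι : Type*} (s : Finset ι) (ψ : ι → Linf n) :
    symbolOp (∑ i ∈ s, ψ i) = ∑ i ∈ s, symbolOp (ψ i) := by
  classical
  induction s using Finset.induction_on with
  | empty =>
    have h := symbolOp_algebraMap (n := n) 0
    rw [map_zero, zero_smul] at h
    simpa using h
  | insert i s hi ih => rw [Finset.sum_insert hi, Finset.sum_insert hi, symbolOp_add, ih]

lemma symbolOp_mulOp (ψ : Linf n) (Φ : C_c(Rn n, ℂ)) (u : L2 n) :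
    symbolOp ψ (mulOp (ofCc Φ) u) = commutator ψ Φ u + mulOp (ofCc Φ) (symbolOp ψ u) := by
  simp [commutator]

/-- Cutoffs localized near a point satisfy the constraints with the coefficients frozen at that
point, up to a small error. -/
lemma exists_norm_sum_symbolOp_le {ι : Type*} [Fintype ι] {K : Set (Rn n)} (hK : IsCompact K)
    (c : ι → Rn n → ℂ) (hc : ∀ i, ContinuousOn (c i) K) (p : ι → symbolAlgebra n)
    {w : ι → ℕ → L2 n} (hw : ∀ i, WeakNull (w i))
    (hconstr : Tendsto (fun r => ∑ i, mulOp (cutSymbol hK (hc i)) (symbolOp (p i).1 (w i r))) atTop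
      (𝓝 0))
    (ρ : C_c(Rn n, ℂ)) (hρ : tsupport ρ ⊆ K) (c₀ : ι → ℂ) {ε : ℝ}
    (hε : ∀ i, ∀ x ∈ tsupport ρ, ‖c₀ i - c i x‖ ≤ ε) (hε0 : 0 ≤ ε) :
    ∃ e : ℕ → ℝ, Tendsto e atTop (𝓝 0) ∧ ∀ r,
      ‖∑ i, c₀ i • symbolOp (p i).1 (mulOp (ofCc ρ) (w i r))‖
        ≤ ε * ∑ i, ‖symbolOp (p i).1‖ * ‖mulOp (ofCc ρ) (w i r)‖ + e r := by
  have hcomm (i : ι) : Tendsto (fun r => commutator (p i).1 ρ (w i r)) atTop (𝓝 0) :=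
    (hw i).compact ((p i).2 ρ)
  refine ⟨fun r => ∑ i, ‖c₀ i‖ * ‖commutator (p i).1 ρ (w i r)‖
    + ‖mulOp (ofCc ρ) (∑ i, mulOp (cutSymbol hK (hc i)) (symbolOp (p i).1 (w i r)))‖
    + ε * ∑ i, ‖commutator (p i).1 ρ (w i r)‖, ?_, fun r => ?_⟩
  · have h1 : Tendsto (fun r => ∑ i, ‖c₀ i‖ * ‖commutator (p i).1 ρ (w i r)‖) atTop (𝓝 0) := by
      simpa using tendsto_finsetSum Finset.univ fun i _ => ((hcomm i).norm.const_mul ‖c₀ i‖)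
    have h2 := (((mulOp (ofCc ρ)).continuous.tendsto 0).comp hconstr).norm
    have h3 : Tendsto (fun r => ε * ∑ i, ‖commutator (p i).1 ρ (w i r)‖) atTop (𝓝 0) := by
      simpa using (tendsto_finsetSum Finset.univ fun i _ => (hcomm i).norm).const_mul ε
    simpa using (h1.add h2).add h3
  · have hdiff (i : ι) : ‖mulOp (ofCc ρ) (c₀ i • symbolOp (p i).1 (w i r)
        - mulOp (cutSymbol hK (hc i)) (symbolOp (p i).1 (w i r)))‖
          ≤ ε * (‖symbolOp (p i).1‖ * ‖mulOp (ofCc ρ) (w i r)‖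
            + ‖commutator (p i).1 ρ (w i r)‖) := by
      have h1 : ‖mulOp (ofCc ρ) (c₀ i • symbolOp (p i).1 (w i r)
        - mulOp (cutSymbol hK (hc i)) (symbolOp (p i).1 (w i r)))‖
          ≤ ε * ‖mulOp (ofCc ρ) (symbolOp (p i).1 (w i r))‖ := by
        refine Lp.norm_le_mul_norm_of_ae_le_mul ?_
        filter_upwards [coeFn_mulOp_ofCc ρ (c₀ i • symbolOp (p i).1 (w i r)
          - mulOp (cutSymbol hK (hc i)) (symbolOp (p i).1 (w i r))),
          coeFn_mulOp_ofCc ρ (symbolOp (p i).1 (w i r)),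
          coeFn_mulOp_cutSymbol hK (hc i) (symbolOp (p i).1 (w i r)),
          Lp.coeFn_sub (c₀ i • symbolOp (p i).1 (w i r))
            (mulOp (cutSymbol hK (hc i)) (symbolOp (p i).1 (w i r))),
          Lp.coeFn_smul (c₀ i) (symbolOp (p i).1 (w i r))] with x h1 h2 h3 h4 h5
        rw [h1, h2, h4, Pi.sub_apply, h3, h5, Pi.smul_apply, smul_eq_mul, ← sub_mul, norm_mul,
          norm_mul, norm_mul]
        by_cases hx : x ∈ tsupport ρ
        · rw [Set.indicator_of_mem (hρ hx)]
          nlinarith [mul_le_mul_of_nonneg_right (hε i x hx)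
            (mul_nonneg (norm_nonneg (ρ x)) (norm_nonneg (symbolOp (p i).1 (w i r) x)))]
        · simp [image_eq_zero_of_notMem_tsupport hx]
      refine h1.trans ?_
      gcongr
      have h2 : mulOp (ofCc ρ) (symbolOp (p i).1 (w i r))
          = symbolOp (p i).1 (mulOp (ofCc ρ) (w i r)) - commutator (p i).1 ρ (w i r) := by
        simp [symbolOp_mulOp]
      rw [h2]
      exact (norm_sub_le _ _).trans (by gcongr; exact ContinuousLinearMap.le_opNorm _ _)
    -- Commuting `ρ` out of the operators leaves commutators, the cut-off constraint, and the error
    -- of freezing. The first two tend to zero; the last is small by `hdiff`, where `ρ` is commuted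
    -- back in so that only the norms of `ρ w` appear.
    have hsplit : ∑ i, c₀ i • symbolOp (p i).1 (mulOp (ofCc ρ) (w i r))
        = ∑ i, c₀ i • commutator (p i).1 ρ (w i r)
          + mulOp (ofCc ρ) (∑ i, mulOp (cutSymbol hK (hc i)) (symbolOp (p i).1 (w i r)))
          + ∑ i, mulOp (ofCc ρ) (c₀ i • symbolOp (p i).1 (w i r)
            - mulOp (cutSymbol hK (hc i)) (symbolOp (p i).1 (w i r))) := by
      simp only [map_sum, ← Finset.sum_add_distrib, symbolOp_mulOp, map_sub, map_smul, smul_add]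
      exact Finset.sum_congr rfl fun i _ => by abel
    have hsum := norm_sum_le_of_le Finset.univ fun i _ => hdiff i
    have hsum' := norm_sum_le_of_le Finset.univ fun i _ =>
      (norm_smul (c₀ i) (commutator (p i).1 ρ (w i r))).le
    rw [← Finset.mul_sum, Finset.sum_add_distrib, mul_add] at hsum
    rw [hsplit]
    refine (norm_add₃_le).trans ?_
    linarith

lemma integrableOn_hermForm {K : Set (Rn n)} (hK : IsCompact K)
    {Q : Rn n → Matrix (Fin N) (Fin N) ℂ} (hQ : ∀ α β, ContinuousOn (fun x => Q x α β) K)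
    {u : Rn n → Fin N → ℂ} (hu : ∀ α, MemLp (fun x => u x α) 2 (volume.restrict K)) :
    IntegrableOn (fun x => hermForm (Q x) (u x)) K := by
  have h : IntegrableOn (fun x => ∑ α, ∑ β, Q x α β * u x α * star (u x β)) K := by
    refine integrable_finsetSum _ fun α _ => integrable_finsetSum _ fun β _ => ?_
    have h1 : IntegrableOn (fun x => u x α * star (u x β)) K :=
      (hu α).integrable_mul (hu β).star
    refine (h1.continuousOn_mul (hQ α β) hK).congr (ae_of_all _ fun x => ?_)
    simp only [mul_assoc]
  exact h.re

lemma integrable_hermForm_cutoff {Ω : Opens (Rn n)} {Q : Rn n → Matrix (Fin N) (Fin N) ℂ}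
    (hQ : ∀ α β, ContinuousOn (fun x => Q x α β) Ω) (ρ : C_c(Rn n, ℂ)) (hρ : tsupport ρ ⊆ Ω)
    (u : Fin N → L2 n) : Integrable (fun x => hermForm (Q x) (fun α => ρ x * u α x)) := by
  rw [← integrableOn_iff_integrable_of_support_subset (s := tsupport ρ)]
  · refine integrableOn_hermForm ρ.hasCompactSupport (fun α β => (hQ α β).mono hρ) fun α => ?_
    exact (((memLp_congr_ae (coeFn_mulOp_ofCc ρ (u α))).1 (Lp.memLp _))).restrict _
  · intro x hx
    by_contra h
    exact hx (by simp [image_eq_zero_of_notMem_tsupport h, hermForm])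

end

/-! ### The lower bound near a point. -/

section

variable {n m N M : ℕ}

/-- The entries of the matrix are continuous, and their differences control the difference of the
forms uniformly on unit vectors. -/
lemma exists_nhds_hermForm_ge {Ω : Opens (Rn n)} {Q : Rn n → Matrix (Fin N) (Fin N) ℂ}
    (hQ : ∀ α β, ContinuousOn (fun x => Q x α β) Ω) {x₀ : Rn n} (hx₀ : x₀ ∈ Ω) {δ : ℝ}
    (hδ : 0 < δ) :
    ∀ᶠ x in 𝓝 x₀, ∀ l, hermForm (Q x₀) l - δ * ∑ α, ‖l α‖ ^ 2 ≤ hermForm (Q x) l := by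
  have hcont : Tendsto (fun x => ∑ α, ∑ β, ‖Q x₀ α β - Q x α β‖) (𝓝 x₀)
      (𝓝 (∑ α, ∑ β, ‖Q x₀ α β - Q x₀ α β‖)) := by
    refine tendsto_finsetSum _ fun α _ => tendsto_finsetSum _ fun β _ => ?_
    exact (tendsto_const_nhds.sub ((hQ α β).continuousAt (Ω.isOpen.mem_nhds hx₀))).norm
  simp only [sub_self, norm_zero, Finset.sum_const_zero] at hcont
  filter_upwards [hcont.eventually (gt_mem_nhds hδ)] with x hx l
  have h1 := (abs_le.1 (abs_hermForm_le (Q x₀ - Q x) l)).2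
  rw [hermForm_sub] at h1
  have h2 : (∑ α, ∑ β, ‖(Q x₀ - Q x) α β‖) * ∑ α, ‖l α‖ ^ 2 ≤ δ * ∑ α, ‖l α‖ ^ 2 := by
    gcongr
    exact hx.le
  linarith

/-- Near each point, the limit of the integrals of the form along cutoffs of the sequence is
nonnegative up to an error that is small relative to the norms of the cutoffs. -/
lemma exists_isOpen_integral_hermForm_ge {Ω : Opens (Rn n)}
    (c : Fin m → Fin N → Fin M → Rn n → ℂ) (hc : ∀ s α k, ContinuousOn (c s α k) Ω)
    (p : Fin m → Fin N → Fin M → symbolAlgebra n)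
    (Q : Rn n → Matrix (Fin N) (Fin N) ℂ) (hQ : ∀ α β, ContinuousOn (fun x => Q x α β) Ω)
    (hq : ∀ x ∈ Ω, ∀ l ∈ characteristicSet c p x, 0 ≤ hermForm (Q x) l)
    {w : Fin N → ℕ → L2 n} (hw : ∀ α, WeakNull (w α))
    (hconstr : ∀ (K : Set (Rn n)) (hK : IsCompact K) (hKΩ : K ⊆ Ω) (s : Fin m),
      Tendsto (fun r => ∑ i : Fin N × Fin M, mulOp (cutSymbol hK ((hc s i.1 i.2).mono hKΩ))
        (symbolOp (p s i.1 i.2).1 (w i.1 r))) atTop (𝓝 0))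
    {x₀ : Rn n} (hx₀ : x₀ ∈ Ω) {δ : ℝ} (hδ : 0 < δ) :
    ∃ U : Set (Rn n), IsOpen U ∧ x₀ ∈ U ∧ U ⊆ Ω ∧ ∀ ρ : C_c(Rn n, ℂ), tsupport ρ ⊆ U →
      ∀ κ : ℝ, 0 < κ → ∀ᶠ r in atTop,
        -δ * ∑ α, ‖mulOp (ofCc ρ) (w α r)‖ ^ 2 - κ
          ≤ ∫ x, hermForm (Q x) (fun α => ρ x * w α r x) := by
  -- One third each for the constant-coefficient estimate, the frozen constraints and the frozen
  -- form.
  have hδ3 : 0 < δ / 3 := by positivity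
  let f (s : Fin m) (α : Fin N) : symbolAlgebra n := ∑ k, c s α k x₀ • p s α k
  have hgf (s α) (η : spectrumS n) :
      gelfand (f s α) η = ∑ k, c s α k x₀ * gelfand (p s α k) η := by
    simp only [f, gelfand]
    change (η.comp (Ideal.Quotient.mkₐ ℂ (vanishingIdeal n))) _ = _
    rw [map_sum]
    refine Finset.sum_congr rfl fun k _ => ?_
    rw [map_smul]
    rfl
  obtain ⟨C, hC, T, hT, hV⟩ := exists_integral_hermForm_ge f (Q x₀)
    (fun η l hl => hq x₀ hx₀ l ⟨η, fun s => by
      simpa only [hgf, Finset.sum_mul] using hl s⟩) hδ3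
  set M₀ : ℝ := ∑ s, ∑ i : Fin N × Fin M, ‖symbolOp (p s i.1 i.2).1‖ with hM₀_def
  have hM₀ : 0 ≤ M₀ := by positivity
  -- The factor `2` comes from `(a + b)² ≤ 2a² + 2b²`, and `m` from summing over the constraints;
  -- `ε` is then chosen so that `D ε² ≤ δ / 3`.
  set D : ℝ := 2 * C * m * M₀ ^ 2 with hD
  have hD0 : 0 ≤ D := by positivity
  set ε : ℝ := √(δ / 3 / (D + 1)) with hε_def
  have hε : 0 < ε := Real.sqrt_pos.2 (by positivity)
  have hεD : D * ε ^ 2 ≤ δ / 3 := by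
    rw [hε_def, Real.sq_sqrt (by positivity), mul_div_assoc', div_le_iff₀ (by positivity)]
    nlinarith
  have hcev : ∀ᶠ x in 𝓝 x₀, ∀ s α k, ‖c s α k x₀ - c s α k x‖ < ε := by
    refine eventually_all.2 fun s => eventually_all.2 fun α => eventually_all.2 fun k => ?_
    have h : Tendsto (fun x => ‖c s α k x₀ - c s α k x‖) (𝓝 x₀) (𝓝 ‖c s α k x₀ - c s α k x₀‖) :=
      (tendsto_const_nhds.sub ((hc s α k).continuousAt (Ω.isOpen.mem_nhds hx₀))).norm
    rw [sub_self, norm_zero] at h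
    exact h.eventually (gt_mem_nhds hε)
  obtain ⟨U, hU, hUo, hxU⟩ := eventually_nhds_iff.1
    ((hcev.and (exists_nhds_hermForm_ge hQ hx₀ hδ3)).and (Ω.isOpen.mem_nhds hx₀))
  refine ⟨U, hUo, hxU, fun x hx => (hU x hx).2, fun ρ hρ κ hκ => ?_⟩
  have hK : IsCompact (tsupport ρ) := ρ.hasCompactSupport
  have hKΩ : tsupport ρ ⊆ Ω := fun x hx => (hU x (hρ hx)).2
  have hest (s : Fin m) := exists_norm_sum_symbolOp_le hK
    (fun i : Fin N × Fin M => c s i.1 i.2) (fun i => (hc s i.1 i.2).mono hKΩ)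
    (fun i => p s i.1 i.2) (w := fun i => w i.1) (fun i => hw i.1)
    (hconstr _ hK hKΩ s) ρ subset_rfl (fun i => c s i.1 i.2 x₀)
    (fun i x hx => ((hU x (hρ hx)).1.1 s i.1 i.2).le) hε.le
  choose e he hest using hest
  have hsmall : Tendsto (fun r => 2 * C * ∑ s, e s r ^ 2
      + C * ∑ α, ∫ ξ in T, ‖(𝓕 (mulOp (ofCc ρ) (w α r)) : L2 n) ξ‖ ^ 2) atTop (𝓝 0) := by
    have h1 := (tendsto_finsetSum Finset.univ fun s _ => (he s).pow 2).const_mul (2 * C)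
    have h2 := (tendsto_finsetSum Finset.univ
      fun α _ => (hw α).tendsto_setIntegral_fourier ρ hT).const_mul C
    simpa using h1.add h2
  filter_upwards [hsmall.eventually (gt_mem_nhds hκ)] with r hr
  set V : Fin N → L2 n := fun α => mulOp (ofCc ρ) (w α r) with hVdef
  have hVρ : ∀ᵐ x ∂(volume : Measure (Rn n)), ∀ α, V α x = ρ x * w α r x :=
    ae_all_iff.2 fun α => coeFn_mulOp_ofCc ρ (w α r)
  set v : ℝ := √(∑ α, ‖V α‖ ^ 2) with hv_def
  have hv2 : v ^ 2 = ∑ α, ‖V α‖ ^ 2 := Real.sq_sqrt (by positivity)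
  have hv0 : 0 ≤ v := Real.sqrt_nonneg _
  have hVv (α : Fin N) : ‖V α‖ ≤ v := Real.le_sqrt_of_sq_le
    (Finset.single_le_sum (f := fun α => ‖V α‖ ^ 2) (fun _ _ => by positivity) (Finset.mem_univ α))
  have hS (s : Fin m) : ‖∑ α, symbolOp (f s α).1 (V α)‖ ^ 2
      ≤ 2 * (ε ^ 2 * M₀ ^ 2 * v ^ 2) + 2 * e s r ^ 2 := by
    have h1 : ∑ α, symbolOp (f s α).1 (V α)
        = ∑ i : Fin N × Fin M, c s i.1 i.2 x₀ • symbolOp (p s i.1 i.2).1 (V i.1) := by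
      rw [Fintype.sum_prod_type]
      refine Finset.sum_congr rfl fun α _ => ?_
      have h2 : (f s α).1 = ∑ k, c s α k x₀ • (p s α k).1 := by simp [f]
      simp [h2, symbolOp_sum, symbolOp_smul, sum_apply]
    have h2 : ∑ i : Fin N × Fin M, ‖symbolOp (p s i.1 i.2).1‖ * ‖V i.1‖ ≤ M₀ * v := by
      calc ∑ i : Fin N × Fin M, ‖symbolOp (p s i.1 i.2).1‖ * ‖V i.1‖
          ≤ ∑ i : Fin N × Fin M, ‖symbolOp (p s i.1 i.2).1‖ * v := by gcongr; exact hVv _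
        _ = (∑ i : Fin N × Fin M, ‖symbolOp (p s i.1 i.2).1‖) * v := by rw [Finset.sum_mul]
        _ ≤ M₀ * v := by
          gcongr
          exact Finset.single_le_sum
            (f := fun s => ∑ i : Fin N × Fin M, ‖symbolOp (p s i.1 i.2).1‖)
            (fun _ _ => by positivity) (Finset.mem_univ s)
    have h3 : ‖∑ α, symbolOp (f s α).1 (V α)‖ ≤ ε * (M₀ * v) + e s r := by
      rw [h1]
      exact (hest s r).trans (by gcongr)
    have h4 := pow_le_pow_left₀ (norm_nonneg _) h3 2
    nlinarith [sq_nonneg (ε * (M₀ * v) - e s r)]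
  have hsumS : C * ∑ s, ‖∑ α, symbolOp (f s α).1 (V α)‖ ^ 2
      ≤ δ / 3 * v ^ 2 + 2 * C * ∑ s, e s r ^ 2 := by
    calc C * ∑ s, ‖∑ α, symbolOp (f s α).1 (V α)‖ ^ 2
        ≤ C * ∑ s, (2 * (ε ^ 2 * M₀ ^ 2 * v ^ 2) + 2 * e s r ^ 2) := by gcongr; exact hS _
      _ = D * ε ^ 2 * v ^ 2 + 2 * C * ∑ s, e s r ^ 2 := by
        simp only [Finset.sum_add_distrib, ← Finset.mul_sum, hD, Finset.sum_const,
          Finset.card_univ, Fintype.card_fin, nsmul_eq_mul]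
        ring
      _ ≤ _ := by gcongr
  have hconst := hV V
  have hpert : (∫ x, hermForm (Q x₀) (fun α => V α x)) - δ / 3 * v ^ 2
      ≤ ∫ x, hermForm (Q x) (fun α => ρ x * w α r x) := by
    have hi := integrable_hermForm_cutoff hQ ρ hKΩ fun α => w α r
    have h1 : Integrable (fun x => δ / 3 * ∑ α, ‖V α x‖ ^ 2) :=
      (integrable_finsetSum _ fun α _ => integrable_norm_sq (V α)).const_mul _
    have h2 := integral_mono_ae ((integrable_hermForm (Q x₀) V).sub h1) hi (by
      filter_upwards [hVρ] with x hx
      simp only [Pi.sub_apply]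
      by_cases hxs : x ∈ tsupport ρ
      · have h3 := (hU x (hρ hxs)).1.2 (fun α => V α x)
        rw [show (fun α => ρ x * w α r x) = fun α => V α x from funext fun α => (hx α).symm]
        exact h3
      · simp [hx, image_eq_zero_of_notMem_tsupport hxs, hermForm])
    simp only [Pi.sub_apply] at h2
    rw [integral_sub (integrable_hermForm (Q x₀) V) h1, integral_const_mul,
      integral_finsetSum _ fun α _ => integrable_norm_sq (V α)] at h2
    simp only [integral_norm_sq] at h2
    rw [hv2]
    exact h2
  rw [← hv2] at hconst ⊢
  linarith

end

/-! ### From local to global by a partition of unity. -/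

section

variable {n m N M : ℕ}

/-- The lower semicontinuity inequality for weakly null sequences in `L²(ℝⁿ)`. -/
lemma eventually_integral_mul_hermForm_ge {Ω : Opens (Rn n)}
    (c : Fin m → Fin N → Fin M → Rn n → ℂ) (hc : ∀ s α k, ContinuousOn (c s α k) Ω)
    (p : Fin m → Fin N → Fin M → symbolAlgebra n)
    (Q : Rn n → Matrix (Fin N) (Fin N) ℂ) (hQ : ∀ α β, ContinuousOn (fun x => Q x α β) Ω)
    (hq : ∀ x ∈ Ω, ∀ l ∈ characteristicSet c p x, 0 ≤ hermForm (Q x) l)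
    {w : Fin N → ℕ → L2 n} (hw : ∀ α, WeakNull (w α))
    (hconstr : ∀ (K : Set (Rn n)) (hK : IsCompact K) (hKΩ : K ⊆ Ω) (s : Fin m),
      Tendsto (fun r => ∑ i : Fin N × Fin M, mulOp (cutSymbol hK ((hc s i.1 i.2).mono hKΩ))
        (symbolOp (p s i.1 i.2).1 (w i.1 r))) atTop (𝓝 0))
    (Φ : C_c(Rn n, ℝ)) (hΦ0 : ∀ x, 0 ≤ Φ x) (hΦ : tsupport Φ ⊆ Ω) {κ : ℝ} (hκ : 0 < κ) :
    ∀ᶠ r in atTop, -κ ≤ ∫ x, Φ x * hermForm (Q x) (fun α => w α r x) := by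
  have hK : IsCompact (tsupport Φ) := Φ.hasCompactSupport
  obtain ⟨S, hS⟩ := hK.exists_bound_of_continuousOn Φ.continuous.continuousOn
  have hΦS (x : Rn n) : Φ x ≤ max S 0 := by
    by_cases hx : x ∈ tsupport Φ
    · exact ((le_abs_self _).trans (hS x hx)).trans (le_max_left _ _)
    · rw [image_eq_zero_of_notMem_tsupport hx]
      exact le_max_right _ _
  choose C hC using fun α => (hw α).bounded
  set B : ℝ := max S 0 * ∑ α, C α ^ 2 with hB_def
  have hB : 0 ≤ B := by positivity
  -- `B` bounds the total squared norm of the cutoffs, so the `δ` terms cost at most `κ / 2`; the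
  -- other half of `κ` is shared among the patches.
  set δ : ℝ := κ / 2 / (B + 1) with hδ_def
  have hδ : 0 < δ := by positivity
  have hδB : δ * B ≤ κ / 2 := by
    rw [hδ_def, div_mul_eq_mul_div, div_le_iff₀ (by positivity)]
    nlinarith
  choose! U hUo hxU hUΩ hU using fun x (hx : x ∈ tsupport Φ) =>
    exists_isOpen_integral_hermForm_ge c hc p Q hQ hq hw hconstr (hΦ hx) hδ
  obtain ⟨t, htK, htU⟩ := hK.elim_nhds_subcover U fun x hx => (hUo x hx).mem_nhds (hxU x hx)
  let y : Fin t.card → Rn n := fun i => t.equivFin.symm i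
  have hy (i) : y i ∈ tsupport Φ := htK _ (t.equivFin.symm i).2
  obtain ⟨f, hfU, hf1, hf01, -⟩ := exists_continuous_sum_one_of_isOpen_isCompact
    (s := fun i => U (y i)) (fun i => hUo _ (hy i)) hK (by
      intro x hx
      obtain ⟨z, hz, hxz⟩ := Set.mem_iUnion₂.1 (htU hx)
      exact Set.mem_iUnion.2 ⟨t.equivFin ⟨z, hz⟩, by simpa [y] using hxz⟩)
  -- Square roots are taken because the form is quadratic: the squares of the `ρ i` sum to `Φ`. They
  -- are merely continuous, which suffices since the commutators are compact for all continuous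
  -- cutoffs.
  let ρ (i : Fin t.card) : C_c(Rn n, ℂ) :=
    { toFun := fun x => (√(Φ x * f i x) : ℝ)
      continuous_toFun := by fun_prop
      hasCompactSupport' := Φ.hasCompactSupport.mono fun x hx h => hx (by simp [h]) }
  have hρ_apply (i x) : ρ i x = (√(Φ x * f i x) : ℝ) := rfl
  have hρ (i) : tsupport (ρ i) ⊆ U (y i) := by
    refine (closure_mono (Function.support_subset_iff'.2 fun x hx => ?_)).trans (hfU i)
    simp [hρ_apply, Function.notMem_support.1 hx]
  have hρΩ (i) : tsupport (ρ i) ⊆ Ω := (hρ i).trans (hUΩ _ (hy i))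
  have hsq (i x) : √(Φ x * f i x) ^ 2 = Φ x * f i x :=
    Real.sq_sqrt (mul_nonneg (hΦ0 x) (hf01 i x).1)
  have hsum (x) : ∑ i, Φ x * f i x = Φ x := by
    rw [← Finset.mul_sum]
    by_cases hx : x ∈ tsupport Φ
    · have h := hf1 hx
      simp only [Finset.sum_apply, Pi.one_apply] at h
      rw [h, mul_one]
    · rw [image_eq_zero_of_notMem_tsupport hx, zero_mul]
  have hev : ∀ᶠ r in atTop, ∀ i, -δ * ∑ α, ‖mulOp (ofCc (ρ i)) (w α r)‖ ^ 2
      - κ / 2 / (t.card + 1) ≤ ∫ x, hermForm (Q x) (fun α => ρ i x * w α r x) :=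
    eventually_all.2 fun i => hU _ (hy i) (ρ i) (hρ i) _ (by positivity)
  filter_upwards [hev] with r hr
  have hform : ∫ x, Φ x * hermForm (Q x) (fun α => w α r x)
      = ∑ i, ∫ x, hermForm (Q x) (fun α => ρ i x * w α r x) := by
    rw [← integral_finsetSum _ fun i _ => integrable_hermForm_cutoff hQ (ρ i) (hρΩ i) _]
    refine integral_congr_ae (ae_of_all _ fun x => ?_)
    simp only [hρ_apply, hermForm_smul, hsq]
    rw [← Finset.sum_mul, hsum]
  have hnorm : ∑ i, ∑ α, ‖mulOp (ofCc (ρ i)) (w α r)‖ ^ 2 ≤ B := by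
    rw [Finset.sum_comm, hB_def, Finset.mul_sum]
    refine Finset.sum_le_sum fun α _ => ?_
    have h1 (i) : ‖mulOp (ofCc (ρ i)) (w α r)‖ ^ 2 = ∫ x, Φ x * f i x * ‖w α r x‖ ^ 2 := by
      rw [← integral_norm_sq]
      refine integral_congr_ae ?_
      filter_upwards [coeFn_mulOp_ofCc (ρ i) (w α r)] with x hx
      rw [hx, norm_mul, mul_pow, hρ_apply, Complex.norm_real, Real.norm_eq_abs, sq_abs, hsq]
    have h2 (i) : Integrable (fun x => Φ x * f i x * ‖w α r x‖ ^ 2) := by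
      refine (integrable_norm_sq (mulOp (ofCc (ρ i)) (w α r))).congr ?_
      filter_upwards [coeFn_mulOp_ofCc (ρ i) (w α r)] with x hx
      rw [hx, norm_mul, mul_pow, hρ_apply, Complex.norm_real, Real.norm_eq_abs, sq_abs, hsq]
    simp only [h1]
    rw [← integral_finsetSum _ fun i _ => h2 i]
    calc ∫ x, ∑ i, Φ x * f i x * ‖w α r x‖ ^ 2
        ≤ ∫ x, max S 0 * ‖w α r x‖ ^ 2 := by
          refine integral_mono (integrable_finsetSum _ fun i _ => h2 i)
            ((integrable_norm_sq _).const_mul _) fun x => ?_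
          simp only
          rw [← Finset.sum_mul, hsum]
          gcongr
          exact hΦS x
      _ = max S 0 * ‖w α r‖ ^ 2 := by rw [integral_const_mul, integral_norm_sq]
      _ ≤ _ := by gcongr; exact hC α r
  have hall := Finset.sum_le_sum fun i (_ : i ∈ Finset.univ) => hr i
  rw [Finset.sum_sub_distrib, ← Finset.mul_sum, Finset.sum_const, Finset.card_univ,
    Fintype.card_fin, nsmul_eq_mul, ← hform] at hall
  have h3 : (t.card : ℝ) * (κ / 2 / (t.card + 1)) ≤ κ / 2 := by
    rw [mul_div_assoc', div_le_iff₀ (by positivity)]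
    nlinarith
  have h4 := mul_le_mul_of_nonneg_left hnorm hδ.le
  linarith

end

/-! ### Inequalities of measures from test functions. -/

section

variable {n : ℕ}

/-- Comparison of finite measures on the subsets of an open set by test functions. -/
lemma measure_le_of_forall_integral_le {μ ν : Measure (Rn n)} [IsFiniteMeasure μ]
    [IsFiniteMeasure ν] {O : Set (Rn n)} (hO : IsOpen O)
    (h : ∀ Φ : C_c(Rn n, ℝ), (∀ x, 0 ≤ Φ x) → tsupport Φ ⊆ O → ∫ x, Φ x ∂μ ≤ ∫ x, Φ x ∂ν)
    {B : Set (Rn n)} (hB : MeasurableSet B) (hBO : B ⊆ O) : μ B ≤ ν B := by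
  -- A Urysohn function between `K` and `V` compares the measures; inner regularity of `μ` and outer
  -- regularity of `ν` then extend this to Borel sets.
  have hKV (K V : Set (Rn n)) (hK : IsCompact K) (hV : IsOpen V) (hKV : K ⊆ V) (hVO : V ⊆ O) :
      μ K ≤ ν V := by
    obtain ⟨L, hL, hKL, hLV⟩ := exists_compact_between hK hV hKV
    obtain ⟨f, hf1, hf0, hfc, hf01⟩ := exists_continuous_one_zero_of_isCompact hK
      isOpen_interior.isClosed_compl (Set.disjoint_compl_right_iff_subset.2 hKL)
    have hfs : tsupport f ⊆ L := by
      refine closure_minimal (fun x hx => ?_) hL.isClosed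
      by_contra hxL
      exact hx (hf0 fun hxi => hxL (interior_subset hxi))
    let Φ : C_c(Rn n, ℝ) := ⟨f, hfc⟩
    have h1 : ∫ x, f x ∂μ ≤ ∫ x, f x ∂ν :=
      h Φ (fun x => (hf01 x).1) ((hfs.trans hLV).trans hVO)
    have h2 : μ.real K ≤ ∫ x, f x ∂μ := by
      rw [← integral_indicator_one hK.measurableSet]
      refine integral_mono ((integrable_const (1 : ℝ)).indicator hK.measurableSet)
        (f.continuous.integrable_of_hasCompactSupport hfc) fun x => ?_
      by_cases hx : x ∈ K
      · simp [hx, hf1 hx]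
      · simpa [hx] using (hf01 x).1
    have h3 : ∫ x, f x ∂ν ≤ ν.real V := by
      rw [← integral_indicator_one hV.measurableSet]
      refine integral_mono (f.continuous.integrable_of_hasCompactSupport hfc)
        ((integrable_const (1 : ℝ)).indicator hV.measurableSet) fun x => ?_
      by_cases hx : x ∈ V
      · simpa [hx] using (hf01 x).2
      · have : f x = 0 := hf0 fun hxi => hx (hLV (interior_subset hxi))
        simp [hx, this]
    exact (ENNReal.toReal_le_toReal (measure_ne_top _ _) (measure_ne_top _ _)).1
      (h2.trans (h1.trans h3))
  rw [hB.measure_eq_iSup_isCompact_of_ne_top (measure_ne_top μ B)]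
  refine iSup_le fun K => iSup_le fun hKB => iSup_le fun hK => ?_
  refine le_trans ?_ (measure_mono hKB)
  rw [K.measure_eq_iInf_isOpen ν]
  refine le_iInf fun V => le_iInf fun hKV' => le_iInf fun hV => ?_
  exact (hKV K (V ∩ O) hK (hV.inter hO) (Set.subset_inter hKV' (hKB.trans hBO))
    Set.inter_subset_right).trans (measure_mono Set.inter_subset_left)

/-- An inequality of measures on `Ω` follows from its integrated form. -/
lemma densityLE_of_forall_integral_le {Ω : Opens (Rn n)} {g : Rn n → ℝ} {v : LocMeasure Ω}
    (hg : ∀ K : Set (Rn n), IsCompact K → K ⊆ Ω → IntegrableOn g K)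
    (h : ∀ Φ : C_c(Rn n, ℝ), (∀ x, 0 ≤ Φ x) → tsupport Φ ⊆ Ω → ∫ x, Φ x * g x ≤ v.pair Φ) :
    DensityLE g v := by
  intro B K hB hK hBK hKΩ
  have hgB : IntegrableOn g B := (hg K hK hKΩ).mono_set hBK
  refine ⟨hgB, ?_⟩
  obtain ⟨L, hL, hKL, hLΩ⟩ := exists_compact_between hK Ω.isOpen hKΩ
  set O := interior L with hO_def
  have hO : IsOpen O := isOpen_interior
  have hOL : O ⊆ L := interior_subset
  have hgO : IntegrableOn g O := (hg L hL hLΩ).mono_set hOL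
  have hfin (μ : Measure (Rn n)) (hμ : μ L < ∞) : IsFiniteMeasure (μ.restrict O) :=
    ⟨by rw [Measure.restrict_apply_univ]; exact (measure_mono hOL).trans_lt hμ⟩
  have hpos := hfin v.pos (v.pos_lt_top L hL hLΩ)
  have hneg := hfin v.neg (v.neg_lt_top L hL hLΩ)
  -- Splitting `g` into its positive and negative parts and moving the negative terms across turns
  -- the claim into an inequality of finite positive measures on `O`.
  set ν₁ := (volume.restrict O).withDensity (fun x => ENNReal.ofReal (g x)) with hν₁
  set ν₂ := (volume.restrict O).withDensity (fun x => ENNReal.ofReal (-g x)) with hν₂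
  have : IsFiniteMeasure ν₁ := isFiniteMeasure_withDensity_ofReal hgO.2
  have : IsFiniteMeasure ν₂ := isFiniteMeasure_withDensity_ofReal hgO.neg.2
  have hint (Φ : C_c(Rn n, ℝ)) (μ : Measure (Rn n)) [IsFiniteMeasure μ] : Integrable Φ μ :=
    Φ.continuous.integrable_of_hasCompactSupport Φ.hasCompactSupport
  have key : (v.neg.restrict O + ν₁) B ≤ (v.pos.restrict O + ν₂) B := by
    refine measure_le_of_forall_integral_le hO (fun Φ hΦ0 hΦ => ?_) hB
      (hBK.trans hKL)
    have e (μ : Measure (Rn n)) : ∫ x in O, Φ x ∂μ = ∫ x, Φ x ∂μ :=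
      setIntegral_eq_integral_of_forall_compl_eq_zero fun x hx =>
        image_eq_zero_of_notMem_tsupport fun hx' => hx (hΦ hx')
    have hm : AEMeasurable g (volume.restrict O) := hgO.1.aemeasurable
    have e₁ : ∫ x, Φ x ∂ν₁ = ∫ x in O, max (g x) 0 * Φ x := by
      rw [hν₁, integral_withDensity_eq_integral_toReal_smul₀ hm.ennreal_ofReal
        (ae_of_all _ fun _ => ENNReal.ofReal_lt_top)]
      simp only [ENNReal.toReal_ofReal', smul_eq_mul]
    have e₂ : ∫ x, Φ x ∂ν₂ = ∫ x in O, max (-g x) 0 * Φ x := by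
      rw [hν₂, integral_withDensity_eq_integral_toReal_smul₀
        (show AEMeasurable (fun x => -g x) _ from hm.neg).ennreal_ofReal
        (ae_of_all _ fun _ => ENNReal.ofReal_lt_top)]
      simp only [ENNReal.toReal_ofReal', smul_eq_mul]
    obtain ⟨S, hS⟩ := Φ.hasCompactSupport.exists_bound_of_continuous Φ.continuous
    have i₁ : IntegrableOn (fun x => max (g x) 0 * Φ x) O :=
      hgO.pos_part.mul_bdd Φ.continuous.aestronglyMeasurable (ae_of_all _ hS)
    have i₂ : IntegrableOn (fun x => max (-g x) 0 * Φ x) O :=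
      hgO.neg_part.mul_bdd Φ.continuous.aestronglyMeasurable (ae_of_all _ hS)
    have hdiff : (∫ x in O, max (g x) 0 * Φ x) - ∫ x in O, max (-g x) 0 * Φ x
        = ∫ x, Φ x * g x := by
      have hset : ∫ x in O, Φ x * g x = ∫ x, Φ x * g x :=
        setIntegral_eq_integral_of_forall_compl_eq_zero fun x hx => by
          simp [image_eq_zero_of_notMem_tsupport fun hx' => hx (hΦ hx')]
      rw [← integral_sub i₁ i₂, ← hset]
      refine integral_congr_ae (ae_of_all _ fun x => ?_)
      simp only
      rw [← sub_mul, max_zero_sub_max_neg_zero_eq_self, mul_comm]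
    have hle := h Φ hΦ0 ((hΦ.trans hOL).trans hLΩ)
    rw [integral_add_measure (hint Φ _) (hint Φ _), integral_add_measure (hint Φ _) (hint Φ _),
      e₁, e₂, e, e]
    unfold LocMeasure.pair at hle
    linarith
  have hBO : B ⊆ O := hBK.trans hKL
  have hr (μ : Measure (Rn n)) : μ.restrict O B = μ B := by
    rw [Measure.restrict_apply hB, Set.inter_eq_left.2 hBO]
  have d₁ : ν₁ B = ∫⁻ x in B, ENNReal.ofReal (g x) := by
    rw [hν₁, withDensity_apply _ hB, Measure.restrict_restrict hB, Set.inter_eq_left.2 hBO]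
  have d₂ : ν₂ B = ∫⁻ x in B, ENNReal.ofReal (-g x) := by
    rw [hν₂, withDensity_apply _ hB, Measure.restrict_restrict hB, Set.inter_eq_left.2 hBO]
  have key' := ENNReal.toReal_mono (measure_ne_top _ _) key
  simp only [Measure.add_apply] at key'
  rw [ENNReal.toReal_add (measure_ne_top _ _) (measure_ne_top _ _),
    ENNReal.toReal_add (measure_ne_top _ _) (measure_ne_top _ _), hr, hr, d₁, d₂] at key'
  rw [integral_eq_lintegral_pos_part_sub_lintegral_neg_part hgB]
  simp only [LocMeasure.value, Measure.real]
  linarith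

end

/-! ### Subtracting the weak limit. -/

section

variable {n m N M : ℕ} {Ω : Opens (Rn n)}

/-- Conjugating one cross term leaves its real part unchanged, so both can be written linearly in
`d`, ready for a weakly null `d` and a fixed `b`. -/
lemma hermForm_add (Q : Matrix (Fin N) (Fin N) ℂ) (d b : Fin N → ℂ) :
    hermForm Q (fun α => d α + b α) = hermForm Q d + hermForm Q b
      + (∑ α, d α * ∑ β, (Q α β + star (Q β α)) * star (b β)).re := by
  have h1 : (∑ α, ∑ β, Q α β * b α * star (d β)).re
      = (∑ α, ∑ β, d α * star (Q β α) * star (b β)).re := by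
    rw [← Complex.conj_re, Finset.sum_comm (γ := Fin N)]
    simp only [map_sum, map_mul, Complex.star_def, Complex.conj_conj]
    congr 1
    exact Finset.sum_congr rfl fun α _ => Finset.sum_congr rfl fun β _ => by ring
  have h2 : ∑ α, d α * ∑ β, (Q α β + star (Q β α)) * star (b β)
      = ∑ α, ∑ β, Q α β * d α * star (b β) + ∑ α, ∑ β, d α * star (Q β α) * star (b β) := by
    simp only [Finset.mul_sum, ← Finset.sum_add_distrib]
    exact Finset.sum_congr rfl fun α _ => Finset.sum_congr rfl fun β _ => by ring
  have h3 : ∑ α, ∑ β, Q α β * (d α + b α) * star (d β + b β)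
      = ∑ α, ∑ β, Q α β * d α * star (d β) + ∑ α, ∑ β, Q α β * b α * star (b β)
        + ∑ α, ∑ β, Q α β * d α * star (b β) + ∑ α, ∑ β, Q α β * b α * star (d β) := by
    simp only [← Finset.sum_add_distrib]
    exact Finset.sum_congr rfl fun α _ => Finset.sum_congr rfl fun β _ => by rw [star_add]; ring
  simp only [hermForm]
  rw [h2, h3]
  simp only [Complex.add_re, h1]
  ring

lemma memLp_continuousOn_mul {K : Set (Rn n)} (hK : IsCompact K) {g f : Rn n → ℂ}
    (hg : ContinuousOn g K) (hf : MemLp f 2 (volume.restrict K)) :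
    MemLp (fun x => g x * f x) 2 (volume.restrict K) :=
  MemLp.mul (r := 2) hf
    ((memLp_indicator_iff_restrict hK.measurableSet).1 (memLp_indicator_of_continuousOn hK hg))

lemma coeFn_cutoff (χ : 𝓓(Ω, ℂ)) {f : Rn n → ℂ} (hf : IsL2Loc Ω f) :
    cutoff χ hf =ᵐ[volume] fun x => χ x * f x :=
  MemLp.coeFn_toLp _

lemma inner_cutoff (χ : 𝓓(Ω, ℂ)) {f : Rn n → ℂ} (hf : IsL2Loc Ω f) (y : L2 n) :
    inner ℂ y (cutoff χ hf) = ∫ x in tsupport χ, f x * (χ x * star (y x)) := by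
  rw [L2.inner_def, setIntegral_eq_integral_of_forall_compl_eq_zero fun x hx => by
    simp [image_eq_zero_of_notMem_tsupport hx]]
  refine integral_congr_ae ?_
  filter_upwards [coeFn_cutoff χ hf] with x hx
  rw [hx, RCLike.inner_apply]
  simp only [Complex.star_def]
  ring

lemma weakNull_cutoff_sub {f : ℕ → Rn n → ℂ} {g : Rn n → ℂ} (hf : ∀ r, IsL2Loc Ω (f r))
    (hg : IsL2Loc Ω g) (h : WeakTendstoL2Loc Ω f g) (χ : 𝓓(Ω, ℂ)) :
    WeakNull fun r => cutoff χ (hf r) - cutoff χ hg := fun y => by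
  have hK : IsCompact (tsupport χ) := χ.hasCompactSupport
  have h1 := h _ hK χ.tsupport_subset (fun x => χ x * star (y x))
    (memLp_continuousOn_mul hK χ.continuous.continuousOn ((Lp.memLp y).star.restrict _))
  simp only [inner_sub_right, inner_cutoff]
  simpa using h1.sub_const (∫ x in tsupport χ, g x * (χ x * star (y x)))

/-- Precompactness of the constraints and weak convergence imply that the constraints applied to
the differences with the limit tend to zero. -/
lemma tendsto_sum_mulOp_cutSymbol_zero {ι : Type*} [Fintype ι] {c : ι → Rn n → ℂ} {K : Set (Rn n)}
    (hK : IsCompact K) (hKΩ : K ⊆ Ω) (hc : ∀ i, ContinuousOn (c i) K)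
    {a : ι → ℕ → L2 n} {b : ι → L2 n} (hab : ∀ i, WeakNull fun r => a i r - b i)
    (hpre : PrecompactL2Loc Ω fun r x => ∑ i, c i x * a i r x) :
    Tendsto (fun r => ∑ i, mulOp (cutSymbol hK (hc i)) (a i r - b i)) atTop (𝓝 0) := by
  -- The sums are weakly null, so strongly convergent subsequences suffice; precompactness provides
  -- these for the part with `a`, while the part with `b` is constant.
  refine WeakNull.tendsto_zero (WeakNull.sum _ fun i => (hab i).clm _) fun σ hσ => ?_
  obtain ⟨τ, hτ, g, hg, hlim⟩ := hpre σ hσ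
  have hgK : MemLp (K.indicator g) 2 volume :=
    (memLp_indicator_iff_restrict hK.measurableSet).2 (hg K hK hKΩ)
  have hG : Tendsto (fun j => ∑ i, mulOp (cutSymbol hK (hc i)) (a i (σ (τ j)))) atTop
      (𝓝 hgK.toLp) := by
    rw [Lp.tendsto_Lp_iff_tendsto_eLpNorm']
    refine (hlim K hK hKΩ).congr fun j => ?_
    rw [← eLpNorm_indicator_eq_eLpNorm_restrict hK.measurableSet]
    refine eLpNorm_congr_ae ?_
    filter_upwards [hgK.coeFn_toLp,
      Lp.coeFn_finsetSum Finset.univ fun i => mulOp (cutSymbol hK (hc i)) (a i (σ (τ j))),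
      ae_all_iff.2 fun i => coeFn_mulOp_cutSymbol hK (hc i) (a i (σ (τ j)))] with x h1 h2 h3
    rw [Pi.sub_apply, h1, h2, Finset.sum_apply]
    simp only [h3]
    by_cases hx : x ∈ K <;> simp [hx]
  refine ⟨τ, hτ, hgK.toLp - ∑ i, mulOp (cutSymbol hK (hc i)) (b i), ?_⟩
  simp only [map_sub, Finset.sum_sub_distrib]
  exact hG.sub_const _

/-- A smooth function with compact support in `Ω` that equals one on a given compact set. -/
lemma exists_testFunction_eq_one {K : Set (Rn n)} (hK : IsCompact K) (hKΩ : K ⊆ Ω) :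
    ∃ χ : 𝓓(Ω, ℂ), ∀ x ∈ K, χ x = 1 := by
  obtain ⟨L, hL, hKL, hLΩ⟩ := exists_compact_between hK Ω.isOpen hKΩ
  obtain ⟨f, hf, -, hfs, hf1⟩ := exists_contMDiff_support_eq_eq_one_iff (n := (⊤ : ℕ∞))
    (modelWithCornersSelf ℝ (Rn n)) (isOpen_interior (s := L)) hK.isClosed hKL
  have hfd : ContDiff ℝ (⊤ : ℕ∞) f := hf.contDiff
  have hsub : tsupport (fun x => (f x : ℂ)) ⊆ L := by
    refine closure_minimal (fun x hx => interior_subset (s := L) ?_) hL.isClosed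
    rw [← hfs]
    exact fun h => hx (by simp [h])
  refine ⟨⟨fun x => (f x : ℂ), Complex.ofRealCLM.contDiff.comp hfd,
    hL.of_isClosed_subset (isClosed_tsupport _) hsub, hsub.trans hLΩ⟩, fun x hx => ?_⟩
  change (f x : ℂ) = 1
  rw [(hf1 x).1 hx, Complex.ofReal_one]

/-- With `u r = (u r - u_lim) + u_lim` in `hermForm_add`, the cross term pairs a weakly null
difference with the fixed `L²` functions `h α`, hence tends to zero. -/
lemma tendsto_integral_mul_hermForm_sub {Q : Rn n → Matrix (Fin N) (Fin N) ℂ}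
    (hQ : ∀ α β, ContinuousOn (fun x => Q x α β) Ω)
    {u : ℕ → Rn n → Fin N → ℂ} {u_lim : Rn n → Fin N → ℂ}
    (hu : ∀ r α, IsL2Loc Ω (fun x => u r x α)) (hu_lim : ∀ α, IsL2Loc Ω (fun x => u_lim x α))
    (hu_weak : ∀ α, WeakTendstoL2Loc Ω (fun r x => u r x α) (fun x => u_lim x α))
    (Φ : C_c(Rn n, ℝ)) (hΦ : tsupport Φ ⊆ Ω) :
    Tendsto (fun r => (∫ x, Φ x * hermForm (Q x) (u r x))
      - ∫ x, Φ x * hermForm (Q x) (fun α => u r x α - u_lim x α)) atTop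
      (𝓝 (∫ x, Φ x * hermForm (Q x) (u_lim x))) := by
  set K := tsupport Φ with hK_def
  have hK : IsCompact K := Φ.hasCompactSupport
  have hset (f : Rn n → ℝ) : ∫ x, Φ x * f x = ∫ x in K, Φ x * f x :=
    (setIntegral_eq_integral_of_forall_compl_eq_zero fun x hx => by
      simp [image_eq_zero_of_notMem_tsupport hx]).symm
  have hQK (α β) : ContinuousOn (fun x => Q x α β) K := (hQ α β).mono hΦ
  have hi {f : Rn n → Fin N → ℂ} (hf : ∀ α, MemLp (fun x => f x α) 2 (volume.restrict K)) :
      IntegrableOn (fun x => Φ x * hermForm (Q x) (f x)) K :=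
    (integrableOn_hermForm hK hQK hf).continuousOn_mul Φ.continuous.continuousOn hK
  have hb (α) : MemLp (fun x => u_lim x α) 2 (volume.restrict K) := hu_lim α K hK hΦ
  have ha (r α) : MemLp (fun x => u r x α) 2 (volume.restrict K) := hu r α K hK hΦ
  have hd (r α) : MemLp (fun x => u r x α - u_lim x α) 2 (volume.restrict K) :=
    (ha r α).sub (hb α)
  set h : Fin N → Rn n → ℂ := fun α x =>
    Φ x * ∑ β, (Q x α β + star (Q x β α)) * star (u_lim x β) with h_def
  have hh (α) : MemLp (h α) 2 (volume.restrict K) := by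
    refine memLp_continuousOn_mul hK (Complex.continuous_ofReal.comp Φ.continuous).continuousOn ?_
    refine memLp_finsetSum _ fun β _ => memLp_continuousOn_mul hK ?_ (hb β).star
    exact (hQK α β).add (hQK β α).star
  have hdh (r α) : Integrable (fun x => (u r x α - u_lim x α) * h α x) (volume.restrict K) :=
    (hd r α).integrable_mul (hh α)
  have hzero : Tendsto (fun r => (∑ α, ∫ x in K, (u r x α - u_lim x α) * h α x).re) atTop
      (𝓝 0) := by
    have h1 : Tendsto (fun r => ∑ α, ∫ x in K, (u r x α - u_lim x α) * h α x) atTop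
        (𝓝 (∑ _α : Fin N, 0)) := by
      refine tendsto_finsetSum _ fun α _ => ?_
      have h2 := (hu_weak α K hK hΦ (h α) (hh α)).sub_const (∫ x in K, u_lim x α * h α x)
      rw [sub_self] at h2
      refine h2.congr fun r => ?_
      have i₁ : Integrable (fun x => u r x α * h α x) (volume.restrict K) :=
        (ha r α).integrable_mul (hh α)
      have i₂ : Integrable (fun x => u_lim x α * h α x) (volume.restrict K) :=
        (hb α).integrable_mul (hh α)
      simp only [sub_mul]
      exact (integral_sub i₁ i₂).symm
    have h3 := (Complex.continuous_re.tendsto _).comp h1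
    rwa [Finset.sum_const_zero, Complex.zero_re] at h3
  have hlim := hzero.const_add (∫ x, Φ x * hermForm (Q x) (u_lim x))
  rw [add_zero] at hlim
  refine hlim.congr fun r => ?_
  have hre : (∑ α, ∫ x in K, (u r x α - u_lim x α) * h α x).re
      = ∫ x in K, (∑ α, (u r x α - u_lim x α) * h α x).re := by
    rw [← integral_finsetSum _ fun α _ => hdh r α]
    exact (integral_re (𝕜 := ℂ) (integrable_finsetSum _ fun α _ => hdh r α)).symm
  have hire : IntegrableOn (fun x => (∑ α, (u r x α - u_lim x α) * h α x).re) K :=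
    Integrable.re (integrable_finsetSum _ fun α _ => hdh r α)
  have hadd : IntegrableOn (fun x => Φ x * hermForm (Q x) (u_lim x)
      + (∑ α, (u r x α - u_lim x α) * h α x).re) K := (hi hb).add hire
  rw [hre, hset, hset, hset, eq_sub_iff_add_eq, ← integral_add (hi hb) hire,
    ← integral_add hadd (hi (hd r))]
  refine integral_congr_ae (ae_of_all _ fun x => ?_)
  have h1 := hermForm_add (Q x) (fun α => u r x α - u_lim x α) (u_lim x)
  simp only [sub_add_cancel] at h1
  have h2 : (∑ α, (u r x α - u_lim x α) * h α x).re = Φ x * (∑ α, (u r x α - u_lim x α)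
      * ∑ β, (Q x α β + star (Q x β α)) * star (u_lim x β)).re := by
    rw [← Complex.re_ofReal_mul, Finset.mul_sum]
    congr 1
    exact Finset.sum_congr rfl fun α _ => by simp only [h_def]; ring
  simp only
  rw [h2]
  change _ = Φ x * hermForm (Q x) (fun α => u r x α)
  rw [h1]
  ring

end

end AdmissibleSymbols

end

theorem theorem3 (n m N M : ℕ) (Ω : Opens (Rn n))
    (c : Fin m → Fin N → Fin M → Rn n → ℂ)
    (hc : ∀ s α k, ContinuousOn (c s α k) Ω)
    (p : Fin m → Fin N → Fin M → symbolAlgebra n)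
    (Q : Rn n → Matrix (Fin N) (Fin N) ℂ)
    (hQ : ∀ α β, ContinuousOn (fun x => Q x α β) Ω)
    (hQ_herm : ∀ x ∈ Ω, (Q x).IsHermitian)
    (u : ℕ → Rn n → Fin N → ℂ) (u_lim : Rn n → Fin N → ℂ)
    (hu : ∀ r α, IsL2Loc Ω (fun x => u r x α))
    (hu_lim : ∀ α, IsL2Loc Ω (fun x => u_lim x α))
    (hu_weak : ∀ α, WeakTendstoL2Loc Ω (fun r x => u r x α) (fun x => u_lim x α))
    (hu_constr : ∀ (Φ : 𝓓(Ω, ℂ)) (s : Fin m), PrecompactL2Loc Ω (fun r x =>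
      ∑ α, ∑ k, c s α k x * symbolOp (p s α k : Linf n) (cutoff Φ (hu r α)) x))
    (v : LocMeasure Ω)
    (hv : WeakTendstoMeasure Ω (fun r x => hermForm (Q x) (u r x)) v)
    (hq : ∀ x ∈ Ω, ∀ l ∈ characteristicSet c p x, 0 ≤ hermForm (Q x) l) :
    DensityLE (fun x => hermForm (Q x) (u_lim x)) v := by
  refine densityLE_of_forall_integral_le (fun K hK hKΩ => integrableOn_hermForm hK
    (fun α β => (hQ α β).mono hKΩ) fun α => hu_lim α K hK hKΩ) fun Φ hΦ0 hΦ => ?_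
  obtain ⟨χ, hχ⟩ := exists_testFunction_eq_one (Ω := Ω) Φ.hasCompactSupport hΦ
  have hw (α : Fin N) : WeakNull fun r => cutoff χ (hu r α) - cutoff χ (hu_lim α) :=
    weakNull_cutoff_sub (fun r => hu r α) (hu_lim α) (hu_weak α) χ
  have hconstr (K : Set (Rn n)) (hK : IsCompact K) (hKΩ : K ⊆ Ω) (s : Fin m) :
      Tendsto (fun r => ∑ i : Fin N × Fin M, mulOp (cutSymbol hK ((hc s i.1 i.2).mono hKΩ))
        (symbolOp (p s i.1 i.2).1 (cutoff χ (hu r i.1) - cutoff χ (hu_lim i.1)))) atTop (𝓝 0) := by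
    have h := tendsto_sum_mulOp_cutSymbol_zero hK hKΩ
      (fun i : Fin N × Fin M => (hc s i.1 i.2).mono hKΩ)
      (a := fun i r => symbolOp (p s i.1 i.2).1 (cutoff χ (hu r i.1)))
      (b := fun i => symbolOp (p s i.1 i.2).1 (cutoff χ (hu_lim i.1)))
      (fun i y => by
        have h := (hw i.1).clm (symbolOp (p s i.1 i.2).1) y
        simp only [map_sub] at h
        exact h)
      (by simpa only [Fintype.sum_prod_type] using hu_constr χ s)
    refine h.congr fun r => Finset.sum_congr rfl fun i _ => ?_
    rw [map_sub (symbolOp (p s i.1 i.2).1)]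
  -- The integrals of `Φ q(u r - u_lim)` therefore tend to `v.pair Φ` minus the integral of `Φ
  -- q(u_lim)`; this limit is at least `-κ` for every `κ > 0`.
  have hlim := (hv Φ hΦ).sub (tendsto_integral_mul_hermForm_sub hQ hu hu_lim hu_weak Φ hΦ)
  simp only [sub_sub_cancel] at hlim
  refine sub_nonneg.1 (le_of_forall_pos_le_add fun κ hκ => ?_)
  rw [← neg_le_iff_add_nonneg]
  refine ge_of_tendsto hlim ?_
  filter_upwards [eventually_integral_mul_hermForm_ge c hc p Q hQ hq
    (w := fun α r => cutoff χ (hu r α) - cutoff χ (hu_lim α)) hw hconstr Φ hΦ0 hΦ hκ]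
    with r hr
  refine hr.trans_eq (integral_congr_ae ?_)
  filter_upwards [ae_all_iff.2 fun α => Lp.coeFn_sub (cutoff χ (hu r α)) (cutoff χ (hu_lim α)),
    ae_all_iff.2 fun α => coeFn_cutoff χ (hu r α), ae_all_iff.2 fun α => coeFn_cutoff χ (hu_lim α)]
    with x h1 h2 h3
  by_cases hx : x ∈ tsupport Φ
  · simp only [h1, Pi.sub_apply, h2, h3, hχ x hx, one_mul]
  · simp [image_eq_zero_of_notMem_tsupport hx]
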